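/- **Setting.** Let $V$ be a finite set of items, $n=|V|$, and let $K=\{1,2\}$ be two agents. Agent $i$ has a preference graph $G_i=(V_i,A_i)$, a directed graph with $V_i\subseteq V$, which is a union of out-stars with pairwise disjoint vertex sets. (An out-tree is an acyclic directed graph with a root $r$ such that there is exactly one path from $r$ to every other vertex; an out-star is an out-tree in which all these paths have length $1$; a single vertex is an out-star.) Let $\mathrm{pred}_i(v)$ be the set of vertices $u\ne v$ of $G_i$ from which there is a path to $v$ in $G_i$. An item $u\in V_i$ is dominated by $v\in V_i$ in $G_i$ if $u=v$ or $v\in\mathrm{pred}_i(u)$. An allocation $\pi$ gives the agents disjoint sets $\pi(1),\pi(2)\subseteq V$. The dissatisfaction $\delta_\pi(i)$ is the number of items of $G_i$ that are not dominated in $G_i$ by any item of $\pi(i)$. An allocation is optimal if it minimizes the total dissatisfaction $\delta_\pi(1)+\delta_\pi(2)$ among all allocations. An item is a personal item of agent $i$ if it lies in $V_i$ but not in the vertex set of the other graph. A one-root item of $G_i$ is an item $v\in V_1\cap V_2$ with $\mathrm{pred}_i(v)=\emptyset$ and $\mathrm{pred}_j(v)\neq\emptyset$ for $j\ne i$. An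 allocation $\pi$ is compliant if 1. each personal item is assigned to its agent; 2. each one-root item $v$ of $G_i$ is assigned to agent $i$, and for every arc $(v,u)\in A_i$ such that $u$ is not a personal item, $u$ is assigned to the other agent $j$, except that if $u$ is also an out-neighbour in $G_j$ of a one-root item of $G_j$, then $u$ is assigned to either one of the two agents. A preassignment is a compliant allocation that assigns only personal items, one-root items, and out-neighbours in $G_i$ of one-root items of $G_i$ ($i\in K$). **Theorem.** (a) There is an algorithm (a program for a random access machine with addition and subtraction) which, given $n$ and the vertex indicator vectors and adjacency matrices of two such graphs $G_1,G_2$ on subsets of $V=\{0,\dots,n-1\}$, outputs an optimal allocation in time bounded by a polynomial in $n$. (b) For every such pair $(G_1,G_2)$ there is an optimal allocation that is compliant. (c) For every such pair $(G_1,G_2)$ a preassignment exists. Let $\pi_0$ be any preassignment and let $G_i'$ be the subgraph of $G_i$ induced by the items not assigned by $\pi_0$. Let $G'$ be the undirected graph with vertex set $V(G_1')\times\{1\}\cup V(G_2')\times\{2\}$ whose edges are the pairs $\{(u,i),(v,i)\}$ with $(u,v)\in A(G_i')$ and the pairs $\{(v,1),(v,2)\}$. Give $(v,i)$ as its weight $w(v,i)$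 the additional satisfaction that $v$ gives to agent $i$, that is, the number of items of $G_i$ that are dominated in $G_i$ by $v$ but by no item of $\pi_0(i)$. Then $G'$ is bipartite. For every independent set $S$ of $G'$, let $\pi_S$ extend $\pi_0$ by assigning $v$ to agent $i$ for each $(v,i)\in S$. Then $\pi_S$ is an allocation, $$\sum_{(v,i)\in S}w(v,i)+\sum_{i}\delta_{\pi_S}(i)=\sum_i\delta_{\pi_0}(i),$$ and $S$ is a maximum-weight independent set of $G'$ if and only if $\pi_S$ is an optimal allocation. -/

import Mathlib

/-! ### Preference graphs -/

/-- A directed graph whose vertices form a finite subset `verts` of the set `V` of items and whose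
arcs are pairs of its vertices. -/
structure PrefGraph (V : Type*) where
  verts : Finset V
  Adj : V → V → Prop
  left_mem : ∀ {u v}, Adj u v → u ∈ verts
  right_mem : ∀ {u v}, Adj u v → v ∈ verts

namespace PrefGraph

/-- `p = (v₀, …, v_ℓ)` is a walk of length `ℓ = p.length - 1` from `u` to `v`. -/
def IsWalk {V : Type*} (G : PrefGraph V) (p : List V) (u v : V) : Prop :=
  (∀ x ∈ p, x ∈ G.verts) ∧ p.IsChain G.Adj ∧ p.head? = some u ∧ p.getLast? = some v

/-- A path is a walk with pairwise distinct vertices. -/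
def IsPath {V : Type*} (G : PrefGraph V) (p : List V) (u v : V) : Prop :=
  G.IsWalk p u v ∧ p.Nodup

/-- A cycle is a closed walk of positive length whose vertices are pairwise distinct, except that
its first and its last vertex agree. -/
def IsCycle {V : Type*} (G : PrefGraph V) (p : List V) : Prop :=
  (∃ v, G.IsWalk p v v) ∧ 2 ≤ p.length ∧ p.tail.Nodup

def IsAcyclic {V : Type*} (G : PrefGraph V) : Prop :=
  ∀ p, ¬ G.IsCycle p

/-- Out-tree with root `r`: acyclic, with exactly one path from `r` to each other vertex. -/
def IsOutTree {V : Type*} (G : PrefGraph V) (r : V) : Prop :=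
  G.IsAcyclic ∧ r ∈ G.verts ∧ ∀ v ∈ G.verts, v ≠ r → ∃! p, G.IsPath p r v

/-- Out-star with root `r`: an out-tree all of whose paths from `r` to another vertex have
length `1`, that is, consist of two vertices. -/
def IsOutStar {V : Type*} (G : PrefGraph V) (r : V) : Prop :=
  G.IsOutTree r ∧ ∀ v ∈ G.verts, v ≠ r → ∀ p, G.IsPath p r v → p.length = 2

/-- `G` is the union of a family of out-stars with pairwise disjoint vertex sets. -/
def IsDisjointUnionOfOutStars {V : Type*} (G : PrefGraph V) : Prop :=
  ∃ F : Set (PrefGraph V),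
    (∀ H ∈ F, ∃ r, H.IsOutStar r) ∧
    (∀ H ∈ F, ∀ H' ∈ F, H ≠ H' → Disjoint H.verts H'.verts) ∧
    (∀ v, v ∈ G.verts ↔ ∃ H ∈ F, v ∈ H.verts) ∧
    (∀ u v, G.Adj u v ↔ ∃ H ∈ F, H.Adj u v)

/-- The set of predecessors of `v`. -/
def pred {V : Type*} (G : PrefGraph V) (v : V) : Set V :=
  {u | u ≠ v ∧ ∃ p, G.IsPath p u v}

/-- Item `u` is dominated by item `v`. -/
def DominatedBy {V : Type*} (G : PrefGraph V) (u v : V) : Prop :=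
  u = v ∨ v ∈ G.pred u

end PrefGraph

/-! ### Allocations and dissatisfaction -/

/-- An allocation gives pairwise disjoint sets of items to the agents (items may stay
unassigned). -/
def IsAllocation {K V : Type*} (π : K → Finset V) : Prop :=
  ∀ i j, i ≠ j → Disjoint (π i) (π j)

open Classical in
/-- The number of items of `G i` that are not dominated by any item given to agent `i`. -/
noncomputable def dissatisfaction {K V : Type*} (G : K → PrefGraph V) (π : K → Finset V) (i : K) :
    ℕ :=
  ((G i).verts.filter fun u => ∀ v ∈ π i, ¬ (G i).DominatedBy u v).card

noncomputable def totalDissatisfaction {K V : Type*} [Fintype K] (G : K → PrefGraph V)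
    (π : K → Finset V) : ℕ :=
  ∑ i, dissatisfaction G π i

/-- `π` is an allocation of minimum total dissatisfaction. -/
def IsOptimal {K V : Type*} [Fintype K] (G : K → PrefGraph V) (π : K → Finset V) : Prop :=
  IsAllocation π ∧
    ∀ π' : K → Finset V, IsAllocation π' → totalDissatisfaction G π ≤ totalDissatisfaction G π'

/-! ### Preassignment for two agents -/

/-- `v` is a personal item of agent `i`: it lies in `G i` but not in the other graph. -/
def IsPersonal {V : Type*} (G : Fin 2 → PrefGraph V) (i : Fin 2) (v : V) : Prop :=
  v ∈ (G i).verts ∧ ∀ j, j ≠ i → v ∉ (G j).verts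

/-- `v` is a one-root item of `G i`: it lies in both graphs, has no predecessor in `G i`, and has a
predecessor in the other graph. -/
def IsOneRoot {V : Type*} (G : Fin 2 → PrefGraph V) (i : Fin 2) (v : V) : Prop :=
  v ∈ (G i).verts ∧ (G i).pred v = ∅ ∧ ∀ j, j ≠ i → v ∈ (G j).verts ∧ ((G j).pred v).Nonempty

/-- `u` is the head of an arc of `G i` whose tail is a one-root item of `G i`. -/
def IsOneRootLeaf {V : Type*} (G : Fin 2 → PrefGraph V) (i : Fin 2) (u : V) : Prop :=
  ∃ v, IsOneRoot G i v ∧ (G i).Adj v u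

/-- Personal items and one-root items go to their agent. A non-personal out-neighbour of a one-root
item of one graph goes to the other agent; if it is such an out-neighbour in both graphs, then it
goes to either of the two agents. -/
def IsCompliant {V : Type*} (G : Fin 2 → PrefGraph V) (π : Fin 2 → Finset V) : Prop :=
  (∀ i v, IsPersonal G i v → v ∈ π i) ∧
  (∀ i v, IsOneRoot G i v → v ∈ π i) ∧
  (∀ i j u, j ≠ i → IsOneRootLeaf G i u → (∀ k, ¬ IsPersonal G k u) →
    (¬ IsOneRootLeaf G j u → u ∈ π j) ∧ (IsOneRootLeaf G j u → ∃ k, u ∈ π k))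

/-- A preassignment: a compliant allocation that assigns no other items than those which compliance
forces it to assign. -/
def IsPreassignment {V : Type*} (G : Fin 2 → PrefGraph V) (π : Fin 2 → Finset V) : Prop :=
  IsAllocation π ∧ IsCompliant G π ∧
    ∀ i, ∀ v ∈ π i, ∃ k, IsPersonal G k v ∨ IsOneRoot G k v ∨ IsOneRootLeaf G k v

/-! ### The weighted graph of the reduction -/

/-- The pairs `(v, i)` in which `v` is an item of `G i` that `π₀` leaves unassigned. -/
abbrev ResidualVertex {V : Type*} (G : Fin 2 → PrefGraph V) (π₀ : Fin 2 → Finset V) : Type _ :=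
  {x : V × Fin 2 // x.1 ∈ (G x.2).verts ∧ ∀ k, x.1 ∉ π₀ k}

/-- The disjoint union of the underlying undirected graphs of the subgraphs of `G 0` and `G 1`
induced by the unassigned items, in which moreover the two copies of each item are joined. -/
def residualGraph {V : Type*} (G : Fin 2 → PrefGraph V) (π₀ : Fin 2 → Finset V) :
    SimpleGraph (ResidualVertex G π₀) :=
  SimpleGraph.fromRel fun x y =>
    (x.1.2 = y.1.2 ∧ (G x.1.2).Adj x.1.1 y.1.1) ∨ (x.1.1 = y.1.1 ∧ x.1.2 ≠ y.1.2)

open Classical in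
/-- The additional satisfaction of agent `i` when she gets `v` on top of `π₀ i`: the number of items
of `G i` that are dominated by `v` but not by any item of `π₀ i`. -/
noncomputable def residualWeight {V : Type*} (G : Fin 2 → PrefGraph V) (π₀ : Fin 2 → Finset V)
    (x : ResidualVertex G π₀) : ℕ :=
  ((G x.1.2).verts.filter fun u =>
    (G x.1.2).DominatedBy u x.1.1 ∧ ∀ v ∈ π₀ x.1.2, ¬ (G x.1.2).DominatedBy u v).card

noncomputable def setWeight {V : Type*} (G : Fin 2 → PrefGraph V) (π₀ : Fin 2 → Finset V)
    (S : Finset (ResidualVertex G π₀)) : ℕ :=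
  ∑ x ∈ S, residualWeight G π₀ x

/-- `S` is an independent set of maximum weight. -/
def IsMaxWeightIndepSet {V : Type*} (G : Fin 2 → PrefGraph V) (π₀ : Fin 2 → Finset V)
    (S : Finset (ResidualVertex G π₀)) : Prop :=
  (residualGraph G π₀).IsIndepSet (S : Set (ResidualVertex G π₀)) ∧
    ∀ T : Finset (ResidualVertex G π₀),
      (residualGraph G π₀).IsIndepSet (T : Set (ResidualVertex G π₀)) →
        setWeight G π₀ T ≤ setWeight G π₀ S

open Classical in
/-- The assignment that extends `π₀` by giving `v` to agent `i` for each `(v, i)` in `S`. -/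
noncomputable def inducedAllocation {V : Type*} (G : Fin 2 → PrefGraph V) (π₀ : Fin 2 → Finset V)
    (S : Finset (ResidualVertex G π₀)) (i : Fin 2) : Finset V :=
  π₀ i ∪ (S.filter fun x => x.1.2 = i).image fun x => x.1.1

/-! ### A random access machine with a step count

Structured programs over variables and arrays that hold natural numbers, with indirect addressing.
Every operation, array access and test costs one unit. The only arithmetic operations are addition
and truncated subtraction, so that the bit length of a value grows by at most one per unit of time,
and polynomial time on this machine is polynomial time on a Turing machine. -/

namespace RAM

/-- Contents of the variables and of the arrays. -/
structure State where
  var : ℕ → ℕ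
  arr : ℕ → ℕ → ℕ

inductive Expr where
  | lit (c : ℕ)
  | var (x : ℕ)
  | read (a : ℕ) (e : Expr)
  | add (e f : Expr)
  | sub (e f : Expr)

def Expr.eval (s : State) : Expr → ℕ
  | .lit c => c
  | .var x => s.var x
  | .read a e => s.arr a (e.eval s)
  | .add e f => e.eval s + f.eval s
  | .sub e f => e.eval s - f.eval s

/-- The number of operations in an expression. -/
def Expr.cost : Expr → ℕ
  | .lit _ => 1
  | .var _ => 1
  | .read _ e => e.cost + 1
  | .add e f => e.cost + f.cost + 1
  | .sub e f => e.cost + f.cost + 1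

inductive Cmd where
  | skip
  | assign (x : ℕ) (e : Expr)
  | write (a : ℕ) (e f : Expr)
  | seq (c d : Cmd)
  | ite (e : Expr) (c d : Cmd)
  | loop (e : Expr) (c : Cmd)

def State.setVar (s : State) (x v : ℕ) : State :=
  { s with var := Function.update s.var x v }

def State.setArr (s : State) (a k v : ℕ) : State :=
  { s with arr := Function.update s.arr a (Function.update (s.arr a) k v) }

/-- `Exec c s t s'`: started in state `s`, the program `c` halts after `t` units of time in
state `s'`. A test succeeds if the value of its expression is nonzero; `loop e c` repeats `c` as
long as the test `e` succeeds. -/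
inductive Exec : Cmd → State → ℕ → State → Prop where
  | skip (s : State) : Exec .skip s 1 s
  | assign (x : ℕ) (e : Expr) (s : State) :
      Exec (.assign x e) s (e.cost + 1) (s.setVar x (e.eval s))
  | write (a : ℕ) (e f : Expr) (s : State) :
      Exec (.write a e f) s (e.cost + f.cost + 1) (s.setArr a (e.eval s) (f.eval s))
  | seq {c d : Cmd} {s s' s'' : State} {t t' : ℕ} :
      Exec c s t s' → Exec d s' t' s'' → Exec (.seq c d) s (t + t') s''
  | ite_true {e : Expr} {c d : Cmd} {s s' : State} {t : ℕ} :
      e.eval s ≠ 0 → Exec c s t s' → Exec (.ite e c d) s (e.cost + 1 + t) s'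
  | ite_false {e : Expr} {c d : Cmd} {s s' : State} {t : ℕ} :
      e.eval s = 0 → Exec d s t s' → Exec (.ite e c d) s (e.cost + 1 + t) s'
  | loop_true {e : Expr} {c : Cmd} {s s' s'' : State} {t t' : ℕ} :
      e.eval s ≠ 0 → Exec c s t s' → Exec (.loop e c) s' t' s'' →
        Exec (.loop e c) s (e.cost + 1 + t + t') s''
  | loop_false {e : Expr} {c : Cmd} {s : State} :
      e.eval s = 0 → Exec (.loop e c) s (e.cost + 1) s

open Classical in
/-- The input: variable `0` holds the number `n` of items, array `i` (for `i = 0, 1`) the indicator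
vector of the vertex set of `G i`, and array `2 + i` the `n × n` adjacency matrix of `G i`, row by
row. All else is `0`. -/
noncomputable def inputState {n : ℕ} (G : Fin 2 → PrefGraph (Fin n)) : State where
  var x := if x = 0 then n else 0
  arr a k :=
    if ∃ i : Fin 2, (a = (i : ℕ) ∧ ∃ v ∈ (G i).verts, k = (v : ℕ)) ∨
        (a = 2 + (i : ℕ) ∧ ∃ u v, (G i).Adj u v ∧ k = (u : ℕ) * n + (v : ℕ))
    then 1 else 0

/-- The output, read off array `4`: item `v` is given to agent `i` if entry `v` is `i + 1`, and to
nobody if that entry is neither `1` nor `2`. -/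
def outputAllocation (n : ℕ) (s : State) (i : Fin 2) : Finset (Fin n) :=
  Finset.univ.filter fun v => s.arr 4 (v : ℕ) = (i : ℕ) + 1

end RAM

/-! In a disjoint union of out-stars an item is dominated only by itself and by its in-neighbour, of
which there is at most one (`IsStarForest`). Hence total dissatisfaction is a sum over items `u` of
`loss` terms that depend only on who holds `u` and its in-neighbours in the two graphs.

Reduction. An item left open by a preassignment lies in both graphs and is a root of both or a leaf
of both, which yields a two-colouring of the residual graph. On an independent set the items newly
dominated for one agent by different vertices form disjoint sets, so weight equals decrease of
dissatisfaction (`setWeight_add_totalDissatisfaction`). Conversely, any allocation can be replaced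
by one induced by an independent set without loss (`IsPreassignment.exists_indepSet_le`): whenever
the preassignment hurts one agent at an item, it helps the other at the same item. Both facts
together identify maximum weight with optimality, and also give a compliant optimum.

Algorithm. It bypasses the residual graph and solves one minimum cut problem with unit capacities on
`n + 2` nodes: the items, a source `n` and a sink `n + 1`. Item `u` becomes an arc from its
in-neighbour in `G 0` to its in-neighbour in `G 1`, with source or sink replacing a missing end. A
root on the source side serves agent `1`, one on the sink side serves agent `0`. The arc of `u` is
then cut when neither agent has `u` dominated through an in-neighbour; since only one of them can
hold `u`, this costs one. `exists_cutSize_le` and `totalDissatisfaction_le_cutSize` translate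
between cuts and allocations, and augmenting paths find a flow whose value equals a cut
(`flowProg_spec`). -/

namespace PrefGraph

/-! ### Structure of unions of out-stars -/

variable {V : Type*} {G : PrefGraph V} {u v w r : V}

/-- Heads of arcs are not tails of arcs, and every vertex has at most one in-neighbour. -/
structure IsStarForest (G : PrefGraph V) : Prop where
  not_adj : ∀ {u v w}, G.Adj u v → ¬ G.Adj v w
  unique : ∀ {u v w}, G.Adj u w → G.Adj v w → u = v

theorem IsStarForest.ne (h : G.IsStarForest) (huv : G.Adj u v) : u ≠ v := by
  rintro rfl
  exact h.not_adj huv huv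

theorem IsAcyclic.not_adj_self (h : G.IsAcyclic) (v : V) : ¬ G.Adj v v := fun hv =>
  h [v, v] ⟨⟨v, by simp [IsWalk, hv, G.left_mem hv]⟩, by simp⟩

theorem isPath_pair (huv : G.Adj u v) (hne : u ≠ v) : G.IsPath [u, v] u v := by
  simp [IsPath, IsWalk, huv, hne, G.left_mem huv, G.right_mem huv]

theorem IsOutStar.adj_root (h : G.IsOutStar r) (hv : v ∈ G.verts) (hne : v ≠ r) :
    G.Adj r v := by
  obtain ⟨p, hp, -⟩ := h.1.2.2 v hv hne
  have hl := h.2 v hv hne p hp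
  obtain ⟨⟨-, hc, hh, ht⟩, -⟩ := hp
  match p, hl with
  | [a, b], _ =>
    simp only [List.head?_cons, Option.some.injEq] at hh
    simp only [List.getLast?_cons_cons, List.getLast?_singleton, Option.some.injEq] at ht
    subst hh ht
    simpa using hc

/-- An arc into the root closes a 2-cycle with the arc from the root to its tail; an arc from a
non-root extends to a path of length two from the root. -/
theorem IsOutStar.eq_root_of_adj (h : G.IsOutStar r) (huv : G.Adj u v) : u = r ∧ v ≠ r := by
  have hirr := h.1.1.not_adj_self
  have hvr : v ≠ r := by
    rintro rfl
    have hu : u ≠ v := by rintro rfl; exact hirr u huv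
    have hvu := h.adj_root (G.left_mem huv) hu
    exact h.1.1 [v, u, v] ⟨⟨v, by simp [IsWalk, huv, hvu, G.left_mem huv, G.right_mem huv]⟩,
      by simp [hu]⟩
  refine ⟨?_, hvr⟩
  by_contra hur
  have hru := h.adj_root (G.left_mem huv) hur
  have huv' : u ≠ v := by rintro rfl; exact hirr u huv
  have := h.2 v (G.right_mem huv) hvr [r, u, v] (by
    simp [IsPath, IsWalk, huv, hru, G.left_mem huv, G.right_mem huv, G.left_mem hru, huv',
      Ne.symm hur, Ne.symm hvr])
  simp at this

theorem IsDisjointUnionOfOutStars.isStarForest (h : G.IsDisjointUnionOfOutStars) :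
    G.IsStarForest := by
  obtain ⟨F, hF, hd, -, hadj⟩ := h
  have same : ∀ H ∈ F, ∀ H' ∈ F, ∀ v, v ∈ H.verts → v ∈ H'.verts → H = H' := by
    intro H hH H' hH' v hv hv'
    by_contra hne
    exact Finset.disjoint_left.1 (hd H hH H' hH' hne) hv hv'
  constructor
  · intro u v w huv hvw
    obtain ⟨H, hH, huv⟩ := (hadj _ _).1 huv
    obtain ⟨H', hH', hvw⟩ := (hadj _ _).1 hvw
    obtain rfl := same H hH H' hH' v (H.right_mem huv) (H'.left_mem hvw)
    obtain ⟨r, hr⟩ := hF H hH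
    exact (hr.eq_root_of_adj huv).2 (hr.eq_root_of_adj hvw).1
  · intro u v w huw hvw
    obtain ⟨H, hH, huw⟩ := (hadj _ _).1 huw
    obtain ⟨H', hH', hvw⟩ := (hadj _ _).1 hvw
    obtain rfl := same H hH H' hH' w (H.right_mem huw) (H'.right_mem hvw)
    obtain ⟨r, hr⟩ := hF H hH
    rw [(hr.eq_root_of_adj huw).1, (hr.eq_root_of_adj hvw).1]

/-- A longer path would contain a vertex that is both head and tail of arcs. -/
theorem IsStarForest.mem_pred_iff (h : G.IsStarForest) : u ∈ G.pred v ↔ G.Adj u v := by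
  constructor
  · rintro ⟨hne, p, ⟨-, hc, hh, ht⟩, -⟩
    match p with
    | [] => simp at hh
    | [a] => simp_all
    | [a, b] => simp_all
    | a :: b :: c :: l =>
      simp only [List.isChain_cons_cons] at hc
      exact absurd hc.2.1 (h.not_adj hc.1)
  · intro huv
    exact ⟨h.ne huv, _, isPath_pair huv (h.ne huv)⟩

theorem IsStarForest.pred_eq_empty_iff (h : G.IsStarForest) :
    G.pred v = ∅ ↔ ∀ u, ¬ G.Adj u v := by
  simp [Set.eq_empty_iff_forall_notMem, h.mem_pred_iff]

theorem IsStarForest.pred_nonempty_iff (h : G.IsStarForest) :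
    (G.pred v).Nonempty ↔ ∃ u, G.Adj u v := by
  simp [Set.Nonempty, h.mem_pred_iff]

theorem IsStarForest.dominatedBy_iff (h : G.IsStarForest) :
    G.DominatedBy u v ↔ u = v ∨ G.Adj v u := by
  rw [DominatedBy, h.mem_pred_iff]

end PrefGraph

/-! ### Dissatisfaction as a sum over items -/

section Loss

variable {V : Type*} (G : Fin 2 → PrefGraph V) (π : Fin 2 → Finset V)

/-- Item `u` of `G i` is not dominated by any item given to agent `i`. -/
def Undominated (i : Fin 2) (u : V) : Prop :=
  u ∈ (G i).verts ∧ ∀ v ∈ π i, ¬ (G i).DominatedBy u v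

open Classical in
/-- The contribution of item `u` to the dissatisfaction of agent `i`. -/
noncomputable def loss (i : Fin 2) (u : V) : ℕ := if Undominated G π i u then 1 else 0

theorem loss_le_one (i : Fin 2) (u : V) : loss G π i u ≤ 1 := by
  unfold loss; split <;> simp

open Classical in
theorem dissatisfaction_eq_card (i : Fin 2) :
    dissatisfaction G π i = ((G i).verts.filter (Undominated G π i)).card := by
  unfold dissatisfaction
  congr 1
  ext u
  rw [Finset.mem_filter, Finset.mem_filter, Undominated]
  tauto

theorem dissatisfaction_eq_sum_loss [Fintype V] (i : Fin 2) :
    dissatisfaction G π i = ∑ u, loss G π i u := by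
  classical
  rw [dissatisfaction_eq_card, Finset.card_filter]
  refine Finset.sum_subset (Finset.subset_univ _) fun u _ hu => ?_
  exact if_neg fun h => hu h.1

theorem totalDissatisfaction_eq_sum_loss [Fintype V] :
    totalDissatisfaction G π = ∑ u, (loss G π 0 u + loss G π 1 u) := by
  rw [totalDissatisfaction, Fin.sum_univ_two, dissatisfaction_eq_sum_loss,
    dissatisfaction_eq_sum_loss, Finset.sum_add_distrib]

end Loss

/-! ### Preassignments and the independent set reduction -/

section Preassignment

variable {V : Type*} {G : Fin 2 → PrefGraph V} {π₀ π : Fin 2 → Finset V}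

theorem Fin.eq_or_eq_of_ne {i j : Fin 2} (h : j ≠ i) (k : Fin 2) : k = i ∨ k = j := by
  revert i j k; decide

theorem undominated_iff (hG : ∀ i, (G i).IsStarForest) {i : Fin 2} {u : V} :
    Undominated G π i u ↔ u ∈ (G i).verts ∧ u ∉ π i ∧ ∀ p, (G i).Adj p u → p ∉ π i := by
  simp only [Undominated, (hG i).dominatedBy_iff, not_or]
  constructor
  · rintro ⟨hu, h⟩
    exact ⟨hu, fun hui => (h u hui).1 rfl, fun p hp hpi => (h p hpi).2 hp⟩
  · rintro ⟨hu, h₁, h₂⟩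
    exact ⟨hu, fun v hv => ⟨by rintro rfl; exact h₁ hv, fun hvu => h₂ v hvu hv⟩⟩

theorem exists_isPreassignment [Fintype V] (hG : ∀ i, (G i).IsStarForest) :
    ∃ π₀, IsPreassignment G π₀ := by
  classical
  -- The third clause excludes personal and one-root items, so it never competes with the first two.
  -- Its last condition breaks ties: an out-neighbour of one-root items in both graphs goes to agent
  -- `0`.
  let π₀ : Fin 2 → Finset V := fun i => Finset.univ.filter fun v =>
    IsPersonal G i v ∨ IsOneRoot G i v ∨ ((∀ k, ¬ IsPersonal G k v) ∧ (∀ k, ¬ IsOneRoot G k v) ∧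
      (∃ j, j ≠ i ∧ IsOneRootLeaf G j v) ∧ (IsOneRootLeaf G i v → i = 0))
  have mem : ∀ i v, v ∈ π₀ i ↔ (IsPersonal G i v ∨ IsOneRoot G i v ∨
      ((∀ k, ¬ IsPersonal G k v) ∧ (∀ k, ¬ IsOneRoot G k v) ∧
      (∃ j, j ≠ i ∧ IsOneRootLeaf G j v) ∧ (IsOneRootLeaf G i v → i = 0))) := by
    intro i v; simp [π₀]
  refine ⟨π₀, ?_, ⟨?_, ?_, ?_⟩, ?_⟩
  · intro i j hij
    rw [Finset.disjoint_left]
    intro v hvi hvj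
    rw [mem] at hvi hvj
    rcases hvi with hvi | hvi | ⟨hi₁, hi₂, ⟨k, hk, hik⟩, hi₃⟩
    · rcases hvj with hvj | hvj | ⟨hj₁, -⟩
      · exact hvi.2 j hij.symm hvj.1
      · exact hvi.2 j hij.symm hvj.1
      · exact hj₁ i hvi
    · rcases hvj with hvj | hvj | ⟨-, hj₂, -⟩
      · exact hvj.2 i hij hvi.1
      · exact (hvj.2.2 i hij).2.ne_empty hvi.2.1
      · exact hj₂ i hvi
    · rcases hvj with hvj | hvj | ⟨-, -, ⟨l, hl, hjl⟩, hj₃⟩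
      · exact hi₁ j hvj
      · exact hi₂ j hvj
      · obtain rfl : k = j := (Fin.eq_or_eq_of_ne hij.symm k).resolve_left hk
        obtain rfl : l = i := (Fin.eq_or_eq_of_ne hij l).resolve_left hl
        exact hij ((hi₃ hjl).trans (hj₃ hik).symm)
  · intro i v h
    exact (mem i v).2 (Or.inl h)
  · intro i v h
    exact (mem i v).2 (Or.inr (Or.inl h))
  · intro i j u hji hi hp
    -- Having an in-neighbour in `G i`, the item `u` can be a one-root item only of `G j`, and then
    -- it is already with `j`, as compliance asks.
    by_cases hr : ∃ k, IsOneRoot G k u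
    · obtain ⟨k, hk⟩ := hr
      rcases Fin.eq_or_eq_of_ne hji k with rfl | rfl
      · obtain ⟨v, -, hvu⟩ := hi
        exact absurd hvu ((hG k).pred_eq_empty_iff.1 hk.2.1 v)
      · have : u ∈ π₀ k := (mem k u).2 (Or.inr (Or.inl hk))
        exact ⟨fun _ => this, fun _ => ⟨k, this⟩⟩
    · push Not at hr
      constructor
      · intro hj
        exact (mem j u).2 (Or.inr (Or.inr ⟨hp, hr, ⟨i, hji.symm, hi⟩, fun h => absurd h hj⟩))
      · intro hj
        refine ⟨0, (mem 0 u).2 (Or.inr (Or.inr ⟨hp, hr, ?_, fun _ => rfl⟩))⟩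
        rcases Fin.eq_or_eq_of_ne hji 0 with h | h
        · exact ⟨j, h ▸ hji, hj⟩
        · exact ⟨i, h ▸ hji.symm, hi⟩
  · intro i v hv
    rcases (mem i v).1 hv with h | h | ⟨-, -, ⟨j, -, h⟩, -⟩
    · exact ⟨i, Or.inl h⟩
    · exact ⟨i, Or.inr (Or.inl h)⟩
    · exact ⟨j, Or.inr (Or.inr h)⟩

theorem IsCompliant.mono (h : IsCompliant G π₀) (hle : ∀ i, π₀ i ⊆ π i) : IsCompliant G π :=
  ⟨fun i v hv => hle i (h.1 i v hv), fun i v hv => hle i (h.2.1 i v hv),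
    fun i j u hji hu hp => ⟨fun hj => hle j ((h.2.2 i j u hji hu hp).1 hj),
      fun hj => ((h.2.2 i j u hji hu hp).2 hj).imp fun k hk => hle k hk⟩⟩

theorem mem_inducedAllocation {S : Finset (ResidualVertex G π₀)} {i : Fin 2} {v : V} :
    v ∈ inducedAllocation G π₀ S i ↔ v ∈ π₀ i ∨ ∃ x ∈ S, x.1 = (v, i) := by
  classical
  simp only [inducedAllocation, Finset.mem_union, Finset.mem_image, Finset.mem_filter]
  refine or_congr_right ⟨?_, ?_⟩
  · rintro ⟨x, ⟨hx, hi⟩, hv⟩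
    exact ⟨x, hx, Prod.ext hv hi⟩
  · rintro ⟨x, hx, h⟩
    exact ⟨x, ⟨hx, by rw [h]⟩, by rw [h]⟩

/-- Items left unassigned by a compliant allocation lie in both graphs. -/
theorem IsCompliant.mem_verts (h : IsCompliant G π₀) (x : ResidualVertex G π₀) (j : Fin 2) :
    x.1.1 ∈ (G j).verts := by
  by_contra hj
  refine x.2.2 x.1.2 (h.1 x.1.2 x.1.1 ⟨x.2.1, fun k hk => ?_⟩)
  have hji : j ≠ x.1.2 := by rintro rfl; exact hj x.2.1
  obtain rfl : k = j := (Fin.eq_or_eq_of_ne hji k).resolve_left hk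
  exact hj

/-- Items left unassigned by a compliant allocation have predecessors in both graphs or in
neither. -/
theorem IsCompliant.exists_adj_iff (h : IsCompliant G π₀) (hG : ∀ i, (G i).IsStarForest)
    (x : ResidualVertex G π₀) (i j : Fin 2) :
    (∃ u, (G i).Adj u x.1.1) ↔ ∃ u, (G j).Adj u x.1.1 := by
  have aux : ∀ i j : Fin 2, (∃ u, (G i).Adj u x.1.1) → ∃ u, (G j).Adj u x.1.1 := by
    intro i j hi
    by_contra hj
    have hij : i ≠ j := by rintro rfl; exact hj hi
    -- Otherwise the item is a one-root item of `G j`, hence assigned.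
    refine x.2.2 j (h.2.1 j x.1.1 ⟨h.mem_verts x j, (hG j).pred_eq_empty_iff.2 (by simpa using hj),
      fun k hk => ?_⟩)
    obtain rfl : k = i := (Fin.eq_or_eq_of_ne hij k).resolve_left hk
    exact ⟨h.mem_verts x k, (hG k).pred_nonempty_iff.2 hi⟩
  exact ⟨aux i j, aux j i⟩

/-- Colour a vertex by the exclusive or of "is a leaf" and its agent. An arc changes the first bit
only; passing to the other copy changes the second only, by `IsCompliant.exists_adj_iff`. -/
theorem IsCompliant.residualGraph_isBipartite (h : IsCompliant G π₀)
    (hG : ∀ i, (G i).IsStarForest) : (residualGraph G π₀).IsBipartite := by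
  classical
  let c : ResidualVertex G π₀ → Bool := fun x =>
    xor (decide (∃ u, (G x.1.2).Adj u x.1.1)) (decide (x.1.2 = 0))
  have key : ∀ x y : ResidualVertex G π₀,
      ((x.1.2 = y.1.2 ∧ (G x.1.2).Adj x.1.1 y.1.1) ∨ (x.1.1 = y.1.1 ∧ x.1.2 ≠ y.1.2)) →
        c x ≠ c y := by
    rintro x y (⟨hxy, hadj⟩ | ⟨hxy, hne⟩)
    · have hx : ¬ ∃ u, (G x.1.2).Adj u x.1.1 := by
        rintro ⟨u, hu⟩
        exact (hG _).not_adj hu hadj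
      have hy : ∃ u, (G x.1.2).Adj u y.1.1 := ⟨_, hadj⟩
      simp only [c, ← hxy, hx, hy]
      simp
    · have hiff : (∃ u, (G x.1.2).Adj u x.1.1) ↔ ∃ u, (G y.1.2).Adj u y.1.1 := by
        rw [← hxy]
        exact h.exists_adj_iff hG x _ _
      simp only [c, hiff]
      generalize x.1.2 = i at hne
      generalize decide (∃ u, (G y.1.2).Adj u y.1.1) = b
      generalize y.1.2 = j at hne
      revert i j b
      decide
  have hcol : (residualGraph G π₀).Colorable (Fintype.card Bool) := by
    refine (SimpleGraph.Coloring.mk c ?_).colorable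
    intro x y hxy
    obtain ⟨-, hxy | hxy⟩ := (SimpleGraph.fromRel_adj _ _ _).1 hxy
    · exact key x y hxy
    · exact (key y x hxy).symm
  exact hcol

variable {S : Finset (ResidualVertex G π₀)}

theorem isAllocation_inducedAllocation (h₀ : IsAllocation π₀)
    (hS : (residualGraph G π₀).IsIndepSet (S : Set (ResidualVertex G π₀))) :
    IsAllocation (inducedAllocation G π₀ S) := by
  intro i j hij
  rw [Finset.disjoint_left]
  intro v hi hj
  rw [mem_inducedAllocation] at hi hj
  rcases hi with hi | ⟨x, hx, hxv⟩
  · rcases hj with hj | ⟨y, hy, hyv⟩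
    · exact Finset.disjoint_left.1 (h₀ i j hij) hi hj
    · have := y.2.2 i
      rw [hyv] at this
      exact this hi
  · rcases hj with hj | ⟨y, hy, hyv⟩
    · have := x.2.2 j
      rw [hxv] at this
      exact this hj
    · have hne : x ≠ y := by
        rintro rfl
        rw [hxv] at hyv
        exact hij (congrArg Prod.snd hyv)
      refine hS hx hy hne ((SimpleGraph.fromRel_adj _ _ _).2 ⟨hne, Or.inl (Or.inr ?_)⟩)
      rw [hxv, hyv]
      exact ⟨rfl, hij⟩

/-- Two distinct items dominate a common item of `G i` only if one is the in-neighbour of the other,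
since in-neighbours are unique. Independence excludes this, so weights add up without double
counting. -/
theorem sum_residualWeight_add_dissatisfaction (hG : ∀ i, (G i).IsStarForest)
    (hS : (residualGraph G π₀).IsIndepSet (S : Set (ResidualVertex G π₀))) (i : Fin 2) :
    ∑ x ∈ S with x.1.2 = i, residualWeight G π₀ x +
      dissatisfaction G (inducedAllocation G π₀ S) i = dissatisfaction G π₀ i := by
  classical
  let W : ResidualVertex G π₀ → Finset V := fun x => (G x.1.2).verts.filter fun u =>
    (G x.1.2).DominatedBy u x.1.1 ∧ ∀ v ∈ π₀ x.1.2, ¬ (G x.1.2).DominatedBy u v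
  have hdis : ∀ x ∈ S.filter (fun x => x.1.2 = i), ∀ y ∈ S.filter (fun x => x.1.2 = i), x ≠ y →
      Disjoint (W x) (W y) := by
    intro x hx y hy hne
    obtain ⟨hx, hxi⟩ := Finset.mem_filter.1 hx
    obtain ⟨hy, hyi⟩ := Finset.mem_filter.1 hy
    have hind := hS hx hy hne
    rw [residualGraph, SimpleGraph.fromRel_adj, not_and] at hind
    have hind := hind hne
    have hv : x.1.1 ≠ y.1.1 := fun h => hne (Subtype.ext (Prod.ext h (hxi.trans hyi.symm)))
    rw [Finset.disjoint_left]
    intro u hux huy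
    simp only [W, Finset.mem_filter, hxi, hyi, (hG i).dominatedBy_iff] at hux huy
    rcases hux.2.1 with h₁ | h₁
    · rcases huy.2.1 with h₂ | h₂
      · exact hv (h₁.symm.trans h₂)
      · refine hind (Or.inr (Or.inl ⟨hyi.trans hxi.symm, ?_⟩))
        rw [hyi, ← h₁]
        exact h₂
    · rcases huy.2.1 with h₂ | h₂
      · refine hind (Or.inl (Or.inl ⟨hxi.trans hyi.symm, ?_⟩))
        rw [hxi, ← h₂]
        exact h₁
      · exact hv ((hG i).unique h₁ h₂)
  have hsum : ∑ x ∈ S with x.1.2 = i, residualWeight G π₀ x =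
      ((S.filter fun x => x.1.2 = i).biUnion W).card := by
    rw [Finset.card_biUnion hdis]
    exact Finset.sum_congr rfl fun x _ => by simp only [residualWeight, W]
  rw [hsum, dissatisfaction, dissatisfaction, ← Finset.card_union_of_disjoint]
  · congr 1
    ext u
    simp only [Finset.mem_union, Finset.mem_biUnion, Finset.mem_filter, W]
    constructor
    · rintro (⟨x, ⟨hx, rfl⟩, hu, -, h⟩ | ⟨hu, h⟩)
      · exact ⟨hu, h⟩
      · exact ⟨hu, fun v hv => h v (mem_inducedAllocation.2 (Or.inl hv))⟩
    · rintro ⟨hu, h⟩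
      by_cases hx : ∃ x ∈ S, x.1.2 = i ∧ (G i).DominatedBy u x.1.1
      · obtain ⟨x, hx, hi, hd⟩ := hx
        exact Or.inl ⟨x, ⟨hx, hi⟩, hi ▸ hu, hi ▸ hd, hi ▸ h⟩
      · refine Or.inr ⟨hu, fun v hv hd => ?_⟩
        rcases mem_inducedAllocation.1 hv with hv | ⟨x, hxS, hxv⟩
        · exact h v hv hd
        · exact hx ⟨x, hxS, by rw [hxv], by rwa [hxv]⟩
  · rw [Finset.disjoint_left]
    intro u hu hu'
    obtain ⟨x, hx, hux⟩ := Finset.mem_biUnion.1 hu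
    obtain ⟨hxS, rfl⟩ := Finset.mem_filter.1 hx
    exact (Finset.mem_filter.1 hu').2 x.1.1 (mem_inducedAllocation.2 (Or.inr ⟨x, hxS, rfl⟩))
      (Finset.mem_filter.1 hux).2.1

theorem setWeight_add_totalDissatisfaction (hG : ∀ i, (G i).IsStarForest)
    (hS : (residualGraph G π₀).IsIndepSet (S : Set (ResidualVertex G π₀))) :
    setWeight G π₀ S + totalDissatisfaction G (inducedAllocation G π₀ S) =
      totalDissatisfaction G π₀ := by
  classical
  simp only [totalDissatisfaction]
  rw [← Finset.sum_congr rfl fun i _ => sum_residualWeight_add_dissatisfaction hG hS i,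
    Finset.sum_add_distrib, setWeight, Finset.sum_fiberwise]

/-- Every allocation is at least as dissatisfying as one obtained from an independent set. -/
theorem IsPreassignment.exists_indepSet_le [Fintype V] (h₀ : IsPreassignment G π₀)
    (hG : ∀ i, (G i).IsStarForest) (hπ : IsAllocation π) :
    ∃ T : Finset (ResidualVertex G π₀),
      (residualGraph G π₀).IsIndepSet (T : Set (ResidualVertex G π₀)) ∧
        totalDissatisfaction G (inducedAllocation G π₀ T) ≤ totalDissatisfaction G π := by
  classical
  have : Fintype (ResidualVertex G π₀) := Fintype.ofFinite _
  obtain ⟨ha, hc, hmin⟩ := h₀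
  -- An open leaf held together with its root is dropped: the root already dominates it.
  let T : Finset (ResidualVertex G π₀) := Finset.univ.filter fun x =>
    x.1.1 ∈ π x.1.2 ∧ ∀ p, (G x.1.2).Adj p x.1.1 → p ∉ π x.1.2
  have memT : ∀ x, x ∈ T ↔ x.1.1 ∈ π x.1.2 ∧ ∀ p, (G x.1.2).Adj p x.1.1 → p ∉ π x.1.2 := by
    intro x; simp [T]
  have hT : (residualGraph G π₀).IsIndepSet (T : Set (ResidualVertex G π₀)) := by
    have aux : ∀ x ∈ T, ∀ y ∈ T, ¬ ((x.1.2 = y.1.2 ∧ (G x.1.2).Adj x.1.1 y.1.1) ∨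
        (x.1.1 = y.1.1 ∧ x.1.2 ≠ y.1.2)) := by
      rintro x hx y hy (⟨hi, hadj⟩ | ⟨hv, hne⟩)
      · rw [memT] at hx hy
        rw [hi] at hadj hx
        exact hy.2 _ hadj hx.1
      · rw [memT] at hx hy
        exact Finset.disjoint_left.1 (hπ _ _ hne) hx.1 (hv ▸ hy.1)
    intro x hx y hy _ hxy
    obtain ⟨-, h | h⟩ := (SimpleGraph.fromRel_adj _ _ _).1 hxy
    · exact aux x hx y hy h
    · exact aux y hy x hx h
  refine ⟨T, hT, ?_⟩
  have hle : ∀ i, π₀ i ⊆ inducedAllocation G π₀ T i := fun i v hv =>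
    mem_inducedAllocation.2 (Or.inl hv)
  -- A preassigned root of `G i` is a personal or one-root item of `i`, so it stays with `i`; an
  -- open one belongs to `T`.
  have root : ∀ i r, r ∈ (G i).verts → (∀ p, ¬ (G i).Adj p r) → r ∈ π i →
      r ∈ inducedAllocation G π₀ T i := by
    intro i r hr hroot hri
    by_cases hr' : ∃ k, r ∈ π₀ k
    · obtain ⟨k, hk⟩ := hr'
      obtain ⟨l, hl | hl | ⟨p, hp, hpr⟩⟩ := hmin k r hk
      · by_cases hli : l = i
        · subst hli
          exact hle l (hc.1 l r hl)
        · exact absurd hr (hl.2 i (Ne.symm hli))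
      · by_cases hli : l = i
        · subst hli
          exact hle l (hc.2.1 l r hl)
        · obtain ⟨p, hp⟩ := (hG i).pred_nonempty_iff.1 (hl.2.2 i (Ne.symm hli)).2
          exact absurd hp (hroot p)
      · by_cases hli : l = i
        · subst hli
          exact absurd hpr (hroot p)
        · refine hle i (hc.2.1 i r ⟨hr, (hG i).pred_eq_empty_iff.2 hroot, fun k hk => ?_⟩)
          obtain rfl : k = l := (Fin.eq_or_eq_of_ne hli k).resolve_left hk
          exact ⟨(G k).right_mem hpr, (hG k).pred_nonempty_iff.2 ⟨p, hpr⟩⟩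
    · push Not at hr'
      exact mem_inducedAllocation.2 (Or.inr ⟨⟨(r, i), hr, hr'⟩,
        (memT _).2 ⟨hri, fun p hp => absurd hp (hroot p)⟩, rfl⟩)
  -- Agent `i` can newly lose `u` only if `π` gave it to `i` and the preassignment takes it away.
  -- Compliance leaves one cause: `u` is a one-root item of `G j`. Then `j` had lost `u` under `π`,
  -- having no predecessor to dominate it, and now holds it.
  have key : ∀ i j u, j ≠ i → loss G (inducedAllocation G π₀ T) i u ≤ loss G π i u ∨
      (loss G (inducedAllocation G π₀ T) j u = 0 ∧ loss G π j u = 1) := by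
    intro i j u hji
    by_cases hu : Undominated G (inducedAllocation G π₀ T) i u
    swap
    · exact Or.inl (by simp [loss, hu])
    by_cases hu' : Undominated G π i u
    · exact Or.inl (by simp [loss, hu'] ; exact loss_le_one G _ i u)
    rw [undominated_iff hG] at hu hu'
    obtain ⟨hui, hnT, hpT⟩ := hu
    have hpπ : ∀ p, (G i).Adj p u → p ∉ π i := fun p hp hpi =>
      hpT p hp (root i p ((G i).left_mem hp) (fun q hq => (hG i).not_adj hq hp) hpi)
    have huπ : u ∈ π i := by
      by_contra h
      exact hu' ⟨hui, h, hpπ⟩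
    have hpers : ¬ IsPersonal G i u := fun h => hnT (hle i (hc.1 i u h))
    have hone : ¬ IsOneRoot G i u := fun h => hnT (hle i (hc.2.1 i u h))
    have hleaf : ¬ IsOneRootLeaf G i u := fun ⟨p, hp, hpu⟩ =>
      hpT p hpu (hle i (hc.2.1 i p hp))
    have hnpers : ∀ k, ¬ IsPersonal G k u := by
      intro k hk
      rcases Fin.eq_or_eq_of_ne hji k with rfl | rfl
      · exact hpers hk
      · exact hk.2 i hji.symm hui
    obtain ⟨k, hk⟩ : ∃ k, u ∈ π₀ k := by
      by_contra h
      push Not at h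
      exact hnT (mem_inducedAllocation.2 (Or.inr ⟨⟨(u, i), hui, h⟩, (memT _).2 ⟨huπ, hpπ⟩, rfl⟩))
    obtain ⟨l, hl | hl | hl⟩ := hmin k u hk
    · exact absurd hl (hnpers l)
    · rcases Fin.eq_or_eq_of_ne hji l with rfl | rfl
      · exact absurd hl hone
      · have huT : u ∈ inducedAllocation G π₀ T l := hle l (hc.2.1 l u hl)
        have h₁ : ¬ Undominated G (inducedAllocation G π₀ T) l u := fun h =>
          ((undominated_iff hG).1 h).2.1 huT
        have h₂ : Undominated G π l u := (undominated_iff hG).2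
          ⟨hl.1, Finset.disjoint_left.1 (hπ i l hji.symm) huπ,
            fun p hp => absurd hp ((hG l).pred_eq_empty_iff.1 hl.2.1 p)⟩
        exact Or.inr ⟨by simp [loss, h₁], by simp [loss, h₂]⟩
    · rcases Fin.eq_or_eq_of_ne hji l with rfl | rfl
      · exact absurd hl hleaf
      · exact absurd (hle i ((hc.2.2 l i u hji.symm hl hnpers).1 hleaf)) hnT
  rw [totalDissatisfaction_eq_sum_loss, totalDissatisfaction_eq_sum_loss]
  refine Finset.sum_le_sum fun u _ => ?_
  have h0 := key 0 1 u (by decide)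
  have h1 := key 1 0 u (by decide)
  have := loss_le_one G (inducedAllocation G π₀ T) 0 u
  have := loss_le_one G (inducedAllocation G π₀ T) 1 u
  omega

theorem IsPreassignment.isMaxWeightIndepSet_iff [Fintype V] (h₀ : IsPreassignment G π₀)
    (hG : ∀ i, (G i).IsStarForest)
    (hS : (residualGraph G π₀).IsIndepSet (S : Set (ResidualVertex G π₀))) :
    IsMaxWeightIndepSet G π₀ S ↔ IsOptimal G (inducedAllocation G π₀ S) := by
  have hwS := setWeight_add_totalDissatisfaction hG hS
  constructor
  · rintro ⟨-, hmax⟩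
    refine ⟨isAllocation_inducedAllocation h₀.1 hS, fun π hπ => ?_⟩
    obtain ⟨T, hT, hle⟩ := h₀.exists_indepSet_le hG hπ
    have := setWeight_add_totalDissatisfaction hG hT
    have := hmax T hT
    omega
  · rintro ⟨-, hopt⟩
    refine ⟨hS, fun T hT => ?_⟩
    have := setWeight_add_totalDissatisfaction hG hT
    have := hopt _ (isAllocation_inducedAllocation h₀.1 hT)
    omega

theorem exists_isOptimal (G : Fin 2 → PrefGraph V) : ∃ π, IsOptimal G π := by
  obtain ⟨π, hπ, hmin⟩ := exists_minimalFor_of_wellFoundedLT (fun π => IsAllocation π)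
    (totalDissatisfaction G) ⟨fun _ => ∅, fun _ _ _ => Finset.disjoint_empty_left _⟩
  exact ⟨π, hπ, fun π' hπ' => (le_total _ _).elim id (hmin hπ')⟩

/-- Replacing an optimum by the extension of a preassignment keeps it optimal, and extensions
inherit compliance. -/
theorem exists_isOptimal_isCompliant [Fintype V] (hG : ∀ i, (G i).IsStarForest) :
    ∃ π, IsOptimal G π ∧ IsCompliant G π := by
  obtain ⟨π, hπ, hopt⟩ := exists_isOptimal G
  obtain ⟨π₀, h₀⟩ := exists_isPreassignment hG
  obtain ⟨T, hT, hle⟩ := h₀.exists_indepSet_le hG hπ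
  exact ⟨inducedAllocation G π₀ T, ⟨isAllocation_inducedAllocation h₀.1 hT,
    fun π' hπ' => hle.trans (hopt π' hπ')⟩,
    h₀.2.1.mono fun i v hv => mem_inducedAllocation.2 (Or.inl hv)⟩

end Preassignment

/-! ### Counting-loop programs and their running time -/

namespace RAM

/-- Programs all of whose loops are counting loops: `loop x c p` runs `p` for the values
`0, …, n + c - 1` of the variable `x`, where `n` is the content of variable `0`. -/
inductive ForProg where
  | skip
  | assign (x : ℕ) (e : Expr)
  | write (a : ℕ) (e f : Expr)
  | seq (p q : ForProg)
  | ite (e : Expr) (p q : ForProg)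
  | loop (x c : ℕ) (p : ForProg)

/-- Apply `f 0, …, f (k - 1)` in this order. -/
def iter (f : ℕ → State → State) : ℕ → State → State
  | 0, s => s
  | k + 1, s => f k (iter f k s)

theorem iter_induction {f : ℕ → State → State} (I : ℕ → State → Prop) {N : ℕ} {s : State}
    (h0 : I 0 s) (hstep : ∀ k < N, ∀ s, I k s → I (k + 1) (f k s)) : I N (iter f N s) := by
  induction N with
  | zero => exact h0
  | succ N ih => exact hstep N (by omega) _ (ih fun k hk => hstep k (by omega))

namespace ForProg

/-- The state in which a program halts. -/
def den : ForProg → State → State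
  | skip, s => s
  | assign x e, s => s.setVar x (e.eval s)
  | write a e f, s => s.setArr a (e.eval s) (f.eval s)
  | seq p q, s => q.den (p.den s)
  | ite e p q, s => if e.eval s ≠ 0 then p.den s else q.den s
  | loop x c p, s =>
    (iter (fun k s => p.den (s.setVar x k)) (s.var 0 + c) s).setVar x (s.var 0 + c)

theorem den_loop (x c : ℕ) (p : ForProg) (s : State) : (loop x c p).den s =
    (iter (fun k s => p.den (s.setVar x k)) (s.var 0 + c) s).setVar x (s.var 0 + c) := rfl

theorem den_loop_arr (x c : ℕ) (p : ForProg) (s : State) : ((loop x c p).den s).arr =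
    (iter (fun k s => p.den (s.setVar x k)) (s.var 0 + c) s).arr := rfl

/-- The translation into the language of the machine. -/
def cmd : ForProg → Cmd
  | skip => .skip
  | assign x e => .assign x e
  | write a e f => .write a e f
  | seq p q => .seq p.cmd q.cmd
  | ite e p q => .ite e p.cmd q.cmd
  | loop x c p => .seq (.assign x (.lit 0)) (.loop (.sub (.add (.var 0) (.lit c)) (.var x))
      (.seq p.cmd (.assign x (.add (.var x) (.lit 1)))))

/-- Does the program assign to variable `x`? -/
def assigns (x : ℕ) : ForProg → Bool
  | skip => false
  | assign y _ => x == y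
  | write _ _ _ => false
  | seq p q => p.assigns x || q.assigns x
  | ite _ p q => p.assigns x || q.assigns x
  | loop y _ p => x == y || p.assigns x

/-- Does the program write to array `a`? -/
def writes (a : ℕ) : ForProg → Bool
  | skip => false
  | assign _ _ => false
  | write b _ _ => a == b
  | seq p q => p.writes a || q.writes a
  | ite _ p q => p.writes a || q.writes a
  | loop _ _ p => p.writes a

/-- Variable `0` is never assigned to, and loop variables are not assigned to in loop bodies. -/
def wf : ForProg → Bool
  | skip => true
  | assign x _ => x != 0
  | write _ _ _ => true
  | seq p q => p.wf && q.wf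
  | ite _ p q => p.wf && q.wf
  | loop x _ p => x != 0 && !p.assigns x && p.wf

open Polynomial in
/-- A bound on the running time in terms of the content of variable `0`. -/
noncomputable def time : ForProg → Polynomial ℕ
  | skip => 1
  | assign _ e => C (e.cost + 1)
  | write _ e f => C (e.cost + f.cost + 1)
  | seq p q => p.time + q.time
  | ite e p q => C (e.cost + 1) + (p.time + q.time)
  | loop _ c p => C 8 + (X + C c) * (p.time + C 10)

theorem var_setVar (s : State) (x y v : ℕ) :
    (s.setVar x v).var y = if y = x then v else s.var y := by
  simp [State.setVar, Function.update_apply]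

theorem den_var {p : ForProg} {x : ℕ} (h : p.assigns x = false) (s : State) :
    (p.den s).var x = s.var x := by
  induction p generalizing s with
  | skip => rfl
  | assign y e =>
    simp only [assigns, beq_eq_false_iff_ne] at h
    simp [den, var_setVar, h]
  | write => rfl
  | seq p q hp hq =>
    simp only [assigns, Bool.or_eq_false_iff] at h
    simp [den, hp h.1, hq h.2]
  | ite e p q hp hq =>
    simp only [assigns, Bool.or_eq_false_iff] at h
    rw [den]
    split
    · exact hp h.1 s
    · exact hq h.2 s
  | loop y c p hp =>
    simp only [assigns, Bool.or_eq_false_iff, beq_eq_false_iff_ne] at h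
    rw [den, var_setVar, if_neg h.1]
    refine iter_induction (fun _ s' => s'.var x = s.var x) rfl fun k _ s' hs' => ?_
    rw [hp h.2, var_setVar, if_neg h.1, hs']

theorem den_arr {p : ForProg} {a : ℕ} (h : p.writes a = false) (s : State) :
    (p.den s).arr a = s.arr a := by
  induction p generalizing s with
  | skip => rfl
  | assign y e => rfl
  | write b e f =>
    simp only [writes, beq_eq_false_iff_ne] at h
    simp [den, State.setArr, h]
  | seq p q hp hq =>
    simp only [writes, Bool.or_eq_false_iff] at h
    simp [den, hp h.1, hq h.2]
  | ite e p q hp hq =>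
    simp only [writes, Bool.or_eq_false_iff] at h
    rw [den]
    split
    · exact hp h.1 s
    · exact hq h.2 s
  | loop y c p hp =>
    rw [writes] at h
    refine iter_induction (f := fun k s => p.den (s.setVar y k))
      (fun _ s' => s'.arr a = s.arr a) rfl fun k _ s' hs' => ?_
    rw [hp h]
    exact hs'

theorem wf.assigns_zero {p : ForProg} (h : p.wf) : p.assigns 0 = false := by
  induction p with
  | skip => rfl
  | assign x e =>
    simp only [wf, bne_iff_ne] at h
    simpa [assigns] using h.symm
  | write => rfl
  | seq p q hp hq =>
    simp only [wf, Bool.and_eq_true] at h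
    simp [assigns, hp h.1, hq h.2]
  | ite e p q hp hq =>
    simp only [wf, Bool.and_eq_true] at h
    simp [assigns, hp h.1, hq h.2]
  | loop x c p hp =>
    simp only [wf, Bool.and_eq_true, bne_iff_ne] at h
    simp [assigns, hp h.2, h.1.1.symm]

/-- Variable `0` never changes, so all nested loops take their trip counts from the same value and
the bounds compose to a polynomial in it. -/
theorem exec_cmd {p : ForProg} (h : p.wf) (s : State) :
    ∃ t, Exec p.cmd s t (p.den s) ∧ t ≤ p.time.eval (s.var 0) := by
  induction p generalizing s with
  | skip => exact ⟨1, .skip s, by simp [time]⟩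
  | assign x e => exact ⟨_, .assign x e s, by simp [time]⟩
  | write a e f => exact ⟨_, .write a e f s, by simp [time]⟩
  | seq p q hp hq =>
    simp only [wf, Bool.and_eq_true] at h
    obtain ⟨t, ht, htle⟩ := hp h.1 s
    obtain ⟨t', ht', htle'⟩ := hq h.2 (p.den s)
    rw [den_var (wf.assigns_zero h.1)] at htle'
    exact ⟨t + t', .seq ht ht', by simpa [time] using add_le_add htle htle'⟩
  | ite e p q hp hq =>
    simp only [wf, Bool.and_eq_true] at h
    rw [den]
    split
    next he =>
      obtain ⟨t, ht, htle⟩ := hp h.1 s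
      exact ⟨_, .ite_true he ht, by simp only [time, Polynomial.eval_add, Polynomial.eval_C]; omega⟩
    next he =>
      obtain ⟨t, ht, htle⟩ := hq h.2 s
      exact ⟨_, .ite_false (not_not.1 he) ht, by
        simp only [time, Polynomial.eval_add, Polynomial.eval_C]; omega⟩
  | loop x c p hp =>
    simp only [wf, Bool.and_eq_true, bne_iff_ne, Bool.not_eq_true'] at h
    obtain ⟨⟨hx, hpx⟩, hwf⟩ := h
    set n := s.var 0 with hn
    set f : ℕ → State → State := fun k s => p.den (s.setVar x k) with hf
    have hvar : ∀ k, (iter f k s).var 0 = n := fun k =>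
      iter_induction (fun _ s' => s'.var 0 = n) hn.symm fun k _ s' hs' => by
        rw [hf]
        simp only
        rw [den_var (wf.assigns_zero hwf), var_setVar, if_neg hx.symm, hs']
    -- Induction on the number `d` of remaining iterations. A test costs 6 and an increment 4, hence
    -- 10 per iteration besides the body; the failing last test and the initial assignment, which
    -- costs 2, make up the 8 in `time`.
    have main : ∀ d k, k + d = n + c → ∃ t,
        Exec (.loop (.sub (.add (.var 0) (.lit c)) (.var x))
          (.seq p.cmd (.assign x (.add (.var x) (.lit 1))))) ((iter f k s).setVar x k) t
          ((iter f (n + c) s).setVar x (n + c)) ∧ t ≤ 6 + d * (p.time.eval n + 10) := by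
      intro d
      induction d with
      | zero =>
        intro k hk
        obtain rfl : k = n + c := by omega
        refine ⟨_, .loop_false ?_, ?_⟩
        · simp [Expr.eval, var_setVar, hx.symm, hvar]
        · simp [Expr.cost]
      | succ d ih =>
        intro k hk
        obtain ⟨t, ht, htle⟩ := ih (k + 1) (by omega)
        obtain ⟨t', ht', htle'⟩ := hp hwf ((iter f k s).setVar x k)
        rw [var_setVar, if_neg hx.symm, hvar] at htle'
        have hstep : Exec (.assign x (.add (.var x) (.lit 1))) (iter f (k + 1) s) 4
            ((iter f (k + 1) s).setVar x (k + 1)) := by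
          have := Exec.assign x (.add (.var x) (.lit 1)) (iter f (k + 1) s)
          have hk : (iter f (k + 1) s).var x = k := by
            rw [iter, hf]
            simp only
            rw [den_var hpx, var_setVar, if_pos rfl]
          simpa [Expr.eval, Expr.cost, hk] using this
        refine ⟨_, .loop_true ?_ (.seq ht' hstep) ht, ?_⟩
        · simp only [Expr.eval, var_setVar, if_neg hx.symm, hvar, if_pos]
          omega
        · simp only [Expr.cost]
          nlinarith
    obtain ⟨t, ht, htle⟩ := main (n + c) 0 (by omega)
    refine ⟨_, .seq (.assign x (.lit 0) s) ht, ?_⟩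
    simp only [time, Expr.cost, Polynomial.eval_add, Polynomial.eval_mul, Polynomial.eval_C,
      Polynomial.eval_X]
    omega

end ForProg

end RAM

/-! ### Flows and cuts -/

/-- The number of arcs, from `A u` to `B u` for `u < n`, that leave the node set `X`. -/
def cutSize (n : ℕ) (A B : ℕ → ℕ) (X : ℕ → Prop) [DecidablePred X] : ℕ :=
  ∑ u ∈ Finset.range n, if X (A u) ∧ ¬ X (B u) then 1 else 0

/-- `F` is a unit-capacity flow of value `val` from node `n` to node `n + 1` in the network with
arcs from `A u` to `B u` for `u < n`; conservation is stated in weak form, against every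
potential. -/
structure IsUnitFlow (n : ℕ) (A B F : ℕ → ℕ) (val : ℕ) : Prop where
  le_one : ∀ u < n, F u ≤ 1
  sum_eq : ∀ φ : ℕ → ℤ, ∑ u ∈ Finset.range n, (F u : ℤ) * (φ (A u) - φ (B u)) =
    val * (φ n - φ (n + 1))

/-- `w` can be reached from `v` through the arc `u`, forwards if the arc carries no flow and
backwards if it does. -/
def Residual (A B F : ℕ → ℕ) (u v w : ℕ) : Prop :=
  (F u = 0 ∧ v = A u ∧ w = B u) ∨ (F u ≠ 0 ∧ v = B u ∧ w = A u)

theorem Residual.right_unique {A B F : ℕ → ℕ} {u v w v' w' : ℕ} (h : Residual A B F u v w)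
    (h' : Residual A B F u v' w') : w = w' := by
  rcases h with ⟨h, -, rfl⟩ | ⟨h, -, rfl⟩ <;> rcases h' with ⟨h', -, rfl⟩ | ⟨h', -, rfl⟩
  · rfl
  · exact absurd h h'
  · exact absurd h' h
  · rfl

/-- No residual arc leaves `X`. -/
def ResidualClosed (n : ℕ) (A B F : ℕ → ℕ) (X : ℕ → Prop) : Prop :=
  ∀ u < n, ∀ v w, Residual A B F u v w → X v → X w

section

variable {n val : ℕ} {A B F : ℕ → ℕ} {X : ℕ → Prop} [DecidablePred X]

/-- The indicator function of `X` is used as potential. -/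
theorem IsUnitFlow.val_eq (h : IsUnitFlow n A B F val) (hs : X n) (ht : ¬ X (n + 1)) :
    (val : ℤ) = ∑ u ∈ Finset.range n,
      (F u : ℤ) * ((if X (A u) then 1 else 0) - (if X (B u) then 1 else 0)) := by
  have := h.sum_eq fun v => if X v then 1 else 0
  simpa [hs, ht] using this.symm

theorem IsUnitFlow.val_le_cutSize (h : IsUnitFlow n A B F val) (hs : X n) (ht : ¬ X (n + 1)) :
    val ≤ cutSize n A B X := by
  zify
  rw [h.val_eq hs ht, cutSize, Nat.cast_sum]
  refine Finset.sum_le_sum fun u hu => ?_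
  have := h.le_one u (Finset.mem_range.1 hu)
  by_cases h₁ : X (A u) <;> by_cases h₂ : X (B u) <;> (simp [h₁, h₂]; try omega)

/-- Closedness forces arcs leaving `X` to carry flow and arcs entering `X` to be empty. -/
theorem IsUnitFlow.val_eq_cutSize (h : IsUnitFlow n A B F val) (hs : X n) (ht : ¬ X (n + 1))
    (hc : ResidualClosed n A B F X) : val = cutSize n A B X := by
  zify
  rw [h.val_eq hs ht, cutSize, Nat.cast_sum]
  refine Finset.sum_congr rfl fun u hu => ?_
  have hu := Finset.mem_range.1 hu
  have h1 := h.le_one u hu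
  by_cases hF : F u = 0
  · have h₁ := hc u hu _ _ (Or.inl ⟨hF, rfl, rfl⟩)
    by_cases h₂ : X (A u)
    · simp [hF, h₁ h₂]
    · simp [hF, h₂]
  · have h₁ := hc u hu _ _ (Or.inr ⟨hF, rfl, rfl⟩)
    have hF1 : F u = 1 := by omega
    by_cases h₂ : X (B u)
    · simp [h₂, h₁ h₂]
    · by_cases h₃ : X (A u) <;> simp [h₂, h₃, hF1]

theorem cutSize_le : cutSize n A B X ≤ n := by
  refine (Finset.sum_le_card_nsmul _ _ 1 fun u _ => ?_).trans (by simp)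
  split <;> simp

end

/-! ### Cuts and allocations -/

section CutAllocation

variable {n : ℕ} {G : Fin 2 → PrefGraph (Fin n)} {A B : ℕ → ℕ}

/-- `A` sends each non-root of `G` to its in-neighbour, roots to `r`, and other items to `a`. -/
def IsParentMap (G : PrefGraph (Fin n)) (r a : ℕ) (A : ℕ → ℕ) : Prop :=
  ∀ u : Fin n, (∃ p : Fin n, G.Adj p u ∧ A u = p) ∨
    ((∀ p, ¬ G.Adj p u) ∧ ((u ∈ G.verts ∧ A u = r) ∨ (u ∉ G.verts ∧ A u = a)))

theorem IsParentMap.lt {G : PrefGraph (Fin n)} {r a : ℕ}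
    (h : IsParentMap G r a A) (hr : r < n + 2) (ha : a < n + 2) : ∀ u < n, A u < n + 2 := by
  intro u hu
  rcases h ⟨u, hu⟩ with ⟨p, -, hp⟩ | ⟨-, ⟨-, hp⟩ | ⟨-, hp⟩⟩ <;> simp only at hp <;> omega

theorem cutSize_eq_sum_fin (X : ℕ → Prop) [DecidablePred X] :
    cutSize n A B X = ∑ u : Fin n, if X (A u) ∧ ¬ X (B u) then 1 else 0 := by
  rw [cutSize, Finset.sum_range]

-- An item whose arc is cut lies in both graphs and is dominated through an in-neighbour for neither
-- agent; the agent who does not hold it loses it.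
open Classical in
theorem exists_cutSize_le (hG : ∀ i, (G i).IsStarForest) (hA : IsParentMap (G 0) n (n + 1) A)
    (hB : IsParentMap (G 1) (n + 1) n B) {π : Fin 2 → Finset (Fin n)} (hπ : IsAllocation π) :
    ∃ X : ℕ → Prop, X n ∧ ¬ X (n + 1) ∧ cutSize n A B X ≤ totalDissatisfaction G π := by
  -- Roots of `G 1` that are not roots of `G 0` may join the source side whoever holds them: they
  -- are not tails of network arcs, so they cause no cut.
  let X : ℕ → Prop := fun v => v = n ∨ ∃ r : Fin n, v = r ∧ r ∈ (G 1).verts ∧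
    (∀ p, ¬ (G 1).Adj p r) ∧ (r ∈ π 1 ∨ r ∉ (G 0).verts ∨ ∃ p, (G 0).Adj p r)
  have Xfin : ∀ r : Fin n, X r ↔ r ∈ (G 1).verts ∧
      (∀ p, ¬ (G 1).Adj p r) ∧ (r ∈ π 1 ∨ r ∉ (G 0).verts ∨ ∃ p, (G 0).Adj p r) := by
    intro r
    constructor
    · rintro (h | ⟨r', h, h'⟩)
      · exact absurd h (by omega)
      · rwa [Fin.ext h]
    · exact fun h => Or.inr ⟨r, rfl, h⟩
  have Xs : X n := Or.inl rfl
  have Xt : ¬ X (n + 1) := by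
    rintro (h | ⟨r, h, -⟩) <;> omega
  refine ⟨X, Xs, Xt, ?_⟩
  rw [cutSize_eq_sum_fin, totalDissatisfaction_eq_sum_loss]
  refine Finset.sum_le_sum fun u _ => ?_
  split
  swap
  · exact Nat.zero_le _
  next h =>
    obtain ⟨hXA, hXB⟩ := h
    have h0 : u ∈ (G 0).verts ∧ ∀ p, (G 0).Adj p u → p ∉ π 0 := by
      rcases hA u with ⟨p, hp, hAp⟩ | ⟨hp, ⟨hu, -⟩ | ⟨-, hAu⟩⟩
      · refine ⟨(G 0).right_mem hp, fun q hq => ?_⟩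
        obtain rfl := (hG 0).unique hq hp
        rw [hAp, Xfin] at hXA
        rcases hXA.2.2 with h | h | ⟨r, h⟩
        · exact Finset.disjoint_right.1 (hπ 0 1 (by decide)) h
        · exact absurd ((G 0).left_mem hq) h
        · exact absurd hq ((hG 0).not_adj h)
      · exact ⟨hu, fun p h => absurd h (hp p)⟩
      · rw [hAu] at hXA
        exact absurd hXA Xt
    have h1 : u ∈ (G 1).verts ∧ ∀ p, (G 1).Adj p u → p ∉ π 1 := by
      rcases hB u with ⟨p, hp, hBp⟩ | ⟨hp, ⟨hu, -⟩ | ⟨-, hBu⟩⟩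
      · refine ⟨(G 1).right_mem hp, fun q hq hqπ => hXB ?_⟩
        obtain rfl := (hG 1).unique hq hp
        rw [hBp, Xfin]
        exact ⟨(G 1).left_mem hq, fun r h => (hG 1).not_adj h hq, Or.inl hqπ⟩
      · exact ⟨hu, fun p h => absurd h (hp p)⟩
      · rw [hBu] at hXB
        exact absurd Xs hXB
    by_cases hu : u ∈ π 0
    · have : Undominated G π 1 u := (undominated_iff hG).2
        ⟨h1.1, Finset.disjoint_left.1 (hπ 0 1 (by decide)) hu, h1.2⟩
      simp [loss, this]
    · have : Undominated G π 0 u := (undominated_iff hG).2 ⟨h0.1, hu, h0.2⟩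
      simp [loss, this]

/-- The allocation encoded by `O` gives item `u` to agent `1` where `O u = 2` and to agent `0` where
`O u = 1`. It is read off a cut `X`. -/
def IsCutAllocation (n : ℕ) (A B : ℕ → ℕ) (X : ℕ → Prop) [DecidablePred X] (O : ℕ → ℕ) : Prop :=
  ∀ u < n, O u =
    if B u = n then 1
    else if B u = n + 1 then (if A u = n ∧ ¬ X u then 1 else 2)
    else if X (A u) then 1 else 2

/-- Roots of `G 0` outside `X` go to agent `0`, roots of `G 1` inside `X` to agent `1`. So agent `0`
can lose `u` only if `A u` is in `X`, and agent `1` only if `B u` is not. If one agent is at risk,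
the rule hands `u` to that agent; if both are, the arc is cut and whoever gets `u` is spared. -/
theorem totalDissatisfaction_le_cutSize (hG : ∀ i, (G i).IsStarForest)
    (hA : IsParentMap (G 0) n (n + 1) A) (hB : IsParentMap (G 1) (n + 1) n B) {X : ℕ → Prop}
    [DecidablePred X] (hs : X n) (ht : ¬ X (n + 1)) {O : ℕ → ℕ} (hO : IsCutAllocation n A B X O)
    {π : Fin 2 → Finset (Fin n)} (hπ : ∀ i u, u ∈ π i ↔ O u = (i : ℕ) + 1) :
    totalDissatisfaction G π ≤ cutSize n A B X := by
  classical
  rw [cutSize_eq_sum_fin, totalDissatisfaction_eq_sum_loss]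
  have nots : ∀ v : Fin n, (v : ℕ) ≠ n := fun v => v.2.ne
  have memA : ∀ u, u ∈ π 0 ↔ O u = 1 := fun u => by rw [hπ]; simp
  have memB : ∀ u, u ∈ π 1 ↔ O u = 2 := fun u => by rw [hπ]; simp
  have rootA : ∀ r, r ∈ (G 0).verts → (∀ p, ¬ (G 0).Adj p r) → ¬ X r → r ∈ π 0 := by
    intro r hr hroot hX
    have hAr : A r = n := by
      rcases hA r with ⟨p, hp, -⟩ | ⟨-, ⟨-, h⟩ | ⟨h, -⟩⟩
      · exact absurd hp (hroot p)
      · exact h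
      · exact absurd hr h
    rw [memA, hO r r.2]
    simp [hAr, hX, hs]
  have rootB : ∀ r, r ∈ (G 1).verts → (∀ p, ¬ (G 1).Adj p r) → X r → r ∈ π 1 := by
    intro r hr hroot hX
    have hBr : B r = n + 1 := by
      rcases hB r with ⟨p, hp, -⟩ | ⟨-, ⟨-, h⟩ | ⟨h, -⟩⟩
      · exact absurd hp (hroot p)
      · exact h
      · exact absurd hr h
    rw [memB, hO r r.2]
    simp [hBr, hX]
  have und : ∀ i u, loss G π i u = if Undominated G π i u then 1 else 0 := by
    intro i u; unfold loss; congr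
  refine Finset.sum_le_sum fun u _ => ?_
  have hOu := hO u u.2
  have lossA : X (A u) ∨ (loss G π 0 u = 0) := by
    by_contra h
    push Not at h
    obtain ⟨hX, hl⟩ := h
    have hl : Undominated G π 0 u := by
      by_contra h; exact hl (by rw [und, if_neg h])
    rw [undominated_iff hG] at hl
    rcases hA u with ⟨p, hp, hAp⟩ | ⟨hp, ⟨hu, hAu⟩ | ⟨hu, -⟩⟩
    · refine hl.2.2 p hp (rootA p ((G 0).left_mem hp) (fun q hq => (hG 0).not_adj hq hp) ?_)
      rwa [hAp] at hX
    · exact hX (by rwa [hAu])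
    · exact hu hl.1
  have lossB : ¬ X (B u) ∨ (loss G π 1 u = 0) := by
    by_contra h
    push Not at h
    obtain ⟨hX, hl⟩ := h
    have hl : Undominated G π 1 u := by
      by_contra h; exact hl (by rw [und, if_neg h])
    rw [undominated_iff hG] at hl
    rcases hB u with ⟨p, hp, hBp⟩ | ⟨hp, ⟨hu, hBu⟩ | ⟨hu, -⟩⟩
    · refine hl.2.2 p hp (rootB p ((G 1).left_mem hp) (fun q hq => (hG 1).not_adj hq hp) ?_)
      rwa [hBp] at hX
    · exact ht (by rwa [hBu] at hX)
    · exact hu hl.1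
  have lossA' : O u = 1 → loss G π 0 u = 0 := fun h => by
    rw [und, if_neg fun h' => ((undominated_iff hG).1 h').2.1 ((memA u).2 h)]
  have lossB' : O u = 2 → loss G π 1 u = 0 := fun h => by
    rw [und, if_neg fun h' => ((undominated_iff hG).1 h').2.1 ((memB u).2 h)]
  have := loss_le_one G π 0 u
  have := loss_le_one G π 1 u
  by_cases hXA : X (A u)
  · by_cases hXB : X (B u)
    · have hne : B u ≠ n + 1 := fun h => ht (by rwa [h] at hXB)
      have := lossA' (by rw [hOu]; simp [hne, hXA])
      have := lossB.resolve_left (not_not.2 hXB)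
      omega
    · have : loss G π 0 u = 0 ∨ loss G π 1 u = 0 := by
        have : O u = 1 ∨ O u = 2 := by rw [hOu]; split_ifs <;> simp
        exact this.imp lossA' lossB'
      rw [if_pos ⟨hXA, hXB⟩]
      omega
  · have h0 := lossA.resolve_left hXA
    have h1 : loss G π 1 u = 0 := by
      by_cases hBn : B u = n
      · have hu : u ∉ (G 1).verts := by
          rcases hB u with ⟨p, -, hp⟩ | ⟨-, ⟨-, h⟩ | ⟨h, -⟩⟩
          · exact absurd (hp.symm.trans hBn) (nots p)
          · omega
          · exact h
        rw [und, if_neg fun h => hu h.1]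
      · have hne : A u ≠ n := fun h => hXA (by rwa [h])
        exact lossB' (by rw [hOu]; simp [hBn, hne, hXA])
    omega

end CutAllocation

/-! ### The allocation program -/

namespace RAM

open RAM.ForProg RAM.Expr

/-! Variable `0` holds `n`. Arrays `5` and `6` hold the tails and heads of the arcs of the network,
array `7` the flow, array `8` the levels of the search (`0` for nodes not reached), and array `9`
the arcs through which nodes were reached. -/

/-- The test whether expressions have different values. -/
def neExpr (e f : Expr) : Expr := add (sub e f) (sub f e)

theorem eval_neExpr {s : State} {e f : Expr} :
    (neExpr e f).eval s ≠ 0 ↔ e.eval s ≠ f.eval s := by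
  simp only [neExpr, Expr.eval]
  omega

theorem den_ite_neExpr {s : State} {e f : Expr} {p q : ForProg} :
    (ForProg.ite (neExpr e f) p q).den s = if e.eval s = f.eval s then q.den s else p.den s := by
  rw [den]
  by_cases h : e.eval s = f.eval s
  · rw [if_pos h, if_neg fun h' => eval_neExpr.1 h' h]
  · rw [if_neg h, if_pos (eval_neExpr.2 h)]

/-- Store in array `out` the parent map of the graph with vertex indicator `vs` and adjacency matrix
`adj`, where roots are sent to `n + r` and items outside the graph to `n + a`. -/
def parentProg (vs adj out r a : ℕ) : ForProg :=
  .loop 1 0 <|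
    .seq (.ite (read vs (var 1)) (.write out (var 1) (add (var 0) (lit r)))
      (.write out (var 1) (add (var 0) (lit a)))) <|
    .seq (.assign 2 (var 1)) <|
    .loop 3 0 <|
      .seq (.ite (read adj (var 2)) (.write out (var 1) (var 3)) .skip)
        (.assign 2 (add (var 2) (var 0)))

/-- If node `x[u]` has been reached and `y[u]` has not, reach `y[u]` through arc `u`, where `u` is
the content of variable `3`. -/
def reachProg (x y : ℕ) : ForProg :=
  .ite (read 8 (read x (var 3)))
    (.ite (read 8 (read y (var 3))) .skip
      (.seq (.write 9 (read y (var 3)) (var 3))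
        (.write 8 (read y (var 3)) (add (read 8 (read x (var 3))) (lit 1))))) .skip

/-- An arc that carries flow is usable only backwards, hence the exchanged arrays. -/
def relaxProg : ForProg :=
  .ite (read 7 (var 3)) (reachProg 6 5) (reachProg 5 6)

/-- There are `n + 2` nodes, so `n + 2` sweeps over the arcs are enough: each one reaches a new node
unless the reached set is closed. -/
def searchProg : ForProg :=
  .seq (.loop 2 2 (.write 8 (var 2) (lit 0))) <|
  .seq (.write 8 (var 0) (lit 1)) <|
  .loop 2 2 (.loop 3 0 relaxProg)

/-- Flip the flow on the arc through which the node in variable `4` was reached, and move to the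
other end of this arc. -/
def walkStepProg : ForProg :=
  .ite (neExpr (var 4) (var 0))
    (.seq (.assign 5 (read 9 (var 4))) <|
      .ite (read 7 (var 5))
        (.seq (.write 7 (var 5) (lit 0)) (.assign 4 (read 6 (var 5))))
        (.seq (.write 7 (var 5) (lit 1)) (.assign 4 (read 5 (var 5)))))
    .skip

/-- If the sink was not reached, the walk starts at the source, where `walkStepProg` is idle. -/
def walkProg : ForProg :=
  .seq (.ite (read 8 (add (var 0) (lit 1))) (.assign 4 (add (var 0) (lit 1))) (.assign 4 (var 0)))
    (.loop 2 2 walkStepProg)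

/-- The flow value is at most `n`; the additional round makes sure that some search fails and leaves
a saturated cut in array `8`. -/
def flowProg : ForProg :=
  .loop 1 1 (.seq searchProg walkProg)

def outputProg : ForProg :=
  .loop 1 0 <|
    .ite (neExpr (read 6 (var 1)) (var 0))
      (.ite (neExpr (read 6 (var 1)) (add (var 0) (lit 1)))
        (.ite (read 8 (read 5 (var 1))) (.write 4 (var 1) (lit 1)) (.write 4 (var 1) (lit 2)))
        (.ite (neExpr (read 5 (var 1)) (var 0)) (.write 4 (var 1) (lit 2))
          (.ite (read 8 (var 1)) (.write 4 (var 1) (lit 2)) (.write 4 (var 1) (lit 1)))))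
      (.write 4 (var 1) (lit 1))

def allocationProg : ForProg :=
  .seq (parentProg 0 2 5 0 1) <| .seq (parentProg 1 3 6 1 0) <| .seq flowProg outputProg

/-! ### Search -/

section Search

variable {n : ℕ} {A B F : ℕ → ℕ}

/-- The number of nodes reached. -/
def reachCount (n : ℕ) (R : ℕ → ℕ) : ℕ := ((Finset.range (n + 2)).filter fun v => R v ≠ 0).card

/-- Levels need not be distances. What matters is that they decrease strictly along the arcs stored
in array `9` and are bounded by the number of reached nodes, so tracing back ends in time. -/
structure SearchInv (n : ℕ) (A B F : ℕ → ℕ) (s : State) : Prop where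
  size : s.var 0 = n
  tail : s.arr 5 = A
  head : s.arr 6 = B
  flow : s.arr 7 = F
  source : s.arr 8 n ≠ 0
  reach : ∀ v < n + 2, s.arr 8 v ≠ 0 → v ≠ n → s.arr 9 v < n ∧
    ∃ w < n + 2, Residual A B F (s.arr 9 v) w v ∧ s.arr 8 w ≠ 0 ∧ s.arr 8 w < s.arr 8 v
  level_le : ∀ v < n + 2, s.arr 8 v ≤ reachCount n (s.arr 8)

theorem SearchInv.setVar {s : State} (h : SearchInv n A B F s) {x : ℕ} (hx : 0 ≠ x) (v : ℕ) :
    SearchInv n A B F (s.setVar x v) :=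
  ⟨by rw [var_setVar, if_neg hx, h.size], h.tail, h.head, h.flow, h.source, h.reach, h.level_le⟩

theorem reachCount_le (R : ℕ → ℕ) : reachCount n R ≤ n + 2 :=
  (Finset.card_filter_le _ _).trans (by simp)

theorem reachCount_update {R : ℕ → ℕ} {w l : ℕ} (hw : w < n + 2) (h0 : R w = 0) (hl : l ≠ 0) :
    reachCount n (Function.update R w l) = reachCount n R + 1 := by
  rw [reachCount, reachCount, ← Finset.card_insert_of_notMem (a := w) (by simp [h0])]
  congr 1
  ext v
  by_cases hv : v = w
  · simp [hv, hl, hw]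
  · simp [hv]

/-- The state after node `w` has been reached from node `v` through arc `u`. -/
def discover (s : State) (u v w : ℕ) : State := (s.setArr 9 w u).setArr 8 w (s.arr 8 v + 1)

theorem discover_level (s : State) (u v w : ℕ) :
    (discover s u v w).arr 8 = Function.update (s.arr 8) w (s.arr 8 v + 1) := by
  simp [discover, State.setArr]

theorem discover_pred (s : State) (u v w : ℕ) :
    (discover s u v w).arr 9 = Function.update (s.arr 9) w u := by
  simp [discover, State.setArr]

theorem den_relaxProg (s : State) :
    (relaxProg.den s = s ∧
      ∀ v w, Residual (s.arr 5) (s.arr 6) (s.arr 7) (s.var 3) v w → s.arr 8 v ≠ 0 → s.arr 8 w ≠ 0) ∨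
    ∃ v w, Residual (s.arr 5) (s.arr 6) (s.arr 7) (s.var 3) v w ∧ s.arr 8 v ≠ 0 ∧ s.arr 8 w = 0 ∧
      relaxProg.den s = discover s (s.var 3) v w := by
  by_cases hF : s.arr 7 (s.var 3) = 0
  · by_cases hv : s.arr 8 (s.arr 5 (s.var 3)) = 0
    · refine Or.inl ⟨by simp [relaxProg, reachProg, den, Expr.eval, hF, hv], ?_⟩
      rintro v w (⟨-, rfl, rfl⟩ | ⟨h, -⟩)
      · exact fun h => absurd hv h
      · exact absurd hF h
    by_cases hw : s.arr 8 (s.arr 6 (s.var 3)) = 0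
    · exact Or.inr ⟨_, _, Or.inl ⟨hF, rfl, rfl⟩, hv, hw, by
        simp [relaxProg, reachProg, den, Expr.eval, hF, hv, hw, discover, State.setArr]⟩
    · refine Or.inl ⟨by simp [relaxProg, reachProg, den, Expr.eval, hF, hv, hw], ?_⟩
      rintro v w (⟨-, rfl, rfl⟩ | ⟨h, -⟩)
      · exact fun _ => hw
      · exact absurd hF h
  · by_cases hv : s.arr 8 (s.arr 6 (s.var 3)) = 0
    · refine Or.inl ⟨by simp [relaxProg, reachProg, den, Expr.eval, hF, hv], ?_⟩
      rintro v w (⟨h, -⟩ | ⟨-, rfl, rfl⟩)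
      · exact absurd h hF
      · exact fun h => absurd hv h
    by_cases hw : s.arr 8 (s.arr 5 (s.var 3)) = 0
    · exact Or.inr ⟨_, _, Or.inr ⟨hF, rfl, rfl⟩, hv, hw, by
        simp [relaxProg, reachProg, den, Expr.eval, hF, hv, hw, discover, State.setArr]⟩
    · refine Or.inl ⟨by simp [relaxProg, reachProg, den, Expr.eval, hF, hv, hw], ?_⟩
      rintro v w (⟨h, -⟩ | ⟨-, rfl, rfl⟩)
      · exact absurd h hF
      · exact fun _ => hw

theorem SearchInv.discover {s : State} (h : SearchInv n A B F s) {u v w : ℕ} (hu : u < n)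
    (hv : v < n + 2) (hw : w < n + 2) (hres : Residual A B F u v w) (hv0 : s.arr 8 v ≠ 0)
    (hw0 : s.arr 8 w = 0) : SearchInv n A B F (discover s u v w) := by
  have hwn : n ≠ w := by
    rintro rfl
    exact h.source hw0
  refine ⟨h.size, h.tail, h.head, h.flow, ?_, ?_, ?_⟩
  · rw [discover_level, Function.update_of_ne hwn]
    exact h.source
  · intro x hx hx0 hxn
    rw [discover_level] at hx0 ⊢
    rw [discover_pred]
    have hne : ∀ y, s.arr 8 y ≠ 0 → y ≠ w := by
      rintro y hy rfl
      exact hy hw0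
    by_cases hxw : x = w
    · subst hxw
      refine ⟨by simpa using hu, v, hv, ?_⟩
      simp [hres, hne v hv0, hv0]
    · rw [Function.update_of_ne hxw] at hx0
      obtain ⟨h₁, y, hy, h₂, h₃, h₄⟩ := h.reach x hx hx0 hxn
      refine ⟨by simpa [hxw] using h₁, y, hy, ?_⟩
      simp [hxw, hne y h₃, h₂, h₃, h₄]
  · intro x hx
    rw [discover_level, reachCount_update hw hw0 (Nat.succ_ne_zero _)]
    by_cases hxw : x = w
    · simpa [hxw] using h.level_le v hv
    · simpa [hxw] using (h.level_le x hx).trans (Nat.le_succ _)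

/-- A sweep that discovers nothing has tested every arc against the same reached set. The first
discovery refutes closedness of the initial set; recording this lets closedness persist through
later sweeps. -/
theorem searchInv_sweep (hA : ∀ u < n, A u < n + 2) (hB : ∀ u < n, B u < n + 2) {s : State}
    (h : SearchInv n A B F s) :
    SearchInv n A B F ((ForProg.loop 3 0 relaxProg).den s) ∧
      (ResidualClosed n A B F (fun v => ((ForProg.loop 3 0 relaxProg).den s).arr 8 v ≠ 0) ∨
        (¬ ResidualClosed n A B F (fun v => s.arr 8 v ≠ 0) ∧
          reachCount n (s.arr 8) < reachCount n (((ForProg.loop 3 0 relaxProg).den s).arr 8))) := by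
  have key := iter_induction (f := fun k s => relaxProg.den (s.setVar 3 k)) (s := s) (N := n)
    (fun k s' => SearchInv n A B F s' ∧
      ((s'.arr 8 = s.arr 8 ∧
        ∀ u < k, ∀ v w, Residual A B F u v w → s.arr 8 v ≠ 0 → s.arr 8 w ≠ 0) ∨
      (¬ ResidualClosed n A B F (fun v => s.arr 8 v ≠ 0) ∧
          reachCount n (s.arr 8) < reachCount n (s'.arr 8))))
    ⟨h, Or.inl ⟨rfl, by simp⟩⟩ (by
      rintro k hk s' ⟨hs', hor⟩
      have hs'' := hs'.setVar (x := 3) (by decide) k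
      have h3 : (s'.setVar 3 k).var 3 = k := by simp [var_setVar]
      have h8 : (s'.setVar 3 k).arr 8 = s'.arr 8 := rfl
      have hrel := den_relaxProg (s'.setVar 3 k)
      rw [hs''.tail, hs''.head, hs''.flow, h3, h8] at hrel
      rcases hrel with ⟨heq, hcl⟩ | ⟨v, w, hres, hv, hw, heq⟩
      · rw [heq]
        refine ⟨hs'', hor.imp_left fun ⟨h₁, h₂⟩ => ⟨h₁, fun u hu => ?_⟩⟩
        rcases Nat.lt_succ_iff_lt_or_eq.1 hu with hu | rfl
        · exact h₂ u hu
        · rwa [h₁] at hcl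
      · rw [heq]
        have hvw : v < n + 2 ∧ w < n + 2 := by
          rcases hres with ⟨-, rfl, rfl⟩ | ⟨-, rfl, rfl⟩
          · exact ⟨hA k hk, hB k hk⟩
          · exact ⟨hB k hk, hA k hk⟩
        refine ⟨hs''.discover hk hvw.1 hvw.2 hres hv hw, Or.inr ?_⟩
        rw [discover_level, h8, reachCount_update hvw.2 hw (Nat.succ_ne_zero _)]
        rcases hor with ⟨h₁, h₂⟩ | ⟨h₁, h₂⟩
        · rw [h₁] at hv hw ⊢
          exact ⟨fun hc => hc k hk v w hres hv hw, Nat.lt_succ_self _⟩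
        · exact ⟨h₁, h₂.trans (Nat.lt_succ_self _)⟩)
  have hN : s.var 0 + 0 = n := by rw [h.size]; rfl
  rw [den, hN]
  refine ⟨key.1.setVar (by decide) n, key.2.imp_left fun ⟨h₁, h₂⟩ => ?_⟩
  intro u hu v w hres
  show (iter _ n s).arr 8 v ≠ 0 → (iter _ n s).arr 8 w ≠ 0
  rw [h₁]
  exact h₂ u hu v w hres

theorem searchInv_searchProg (hA : ∀ u < n, A u < n + 2) (hB : ∀ u < n, B u < n + 2) {s : State}
    (h0 : s.var 0 = n) (h5 : s.arr 5 = A) (h6 : s.arr 6 = B) (h7 : s.arr 7 = F) :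
    SearchInv n A B F (searchProg.den s) ∧
      ResidualClosed n A B F (fun v => (searchProg.den s).arr 8 v ≠ 0) := by
  obtain ⟨s₁, hs₁⟩ : ∃ s₁, s₁ = (ForProg.seq (.loop 2 2 (.write 8 (var 2) (lit 0)))
    (.write 8 (var 0) (lit 1))).den s := ⟨_, rfl⟩
  have hden : searchProg.den s = (ForProg.loop 2 2 (.loop 3 0 relaxProg)).den s₁ := by
    rw [hs₁]; rfl
  have hclear := iter_induction
    (f := fun k s => (ForProg.write 8 (var 2) (lit 0)).den (s.setVar 2 k)) (s := s) (N := n + 2)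
    (fun k s' => ∀ v < k, s'.arr 8 v = 0) (by simp) (by
      intro k hk s' hs' v hv
      by_cases hvk : v = k
      · simp [den, Expr.eval, State.setArr, State.setVar, hvk]
      · simpa [den, Expr.eval, State.setArr, State.setVar, hvk] using hs' v (by omega))
  have h0₁ : s₁.var 0 = n := by rw [hs₁, den_var (by decide), h0]
  have hlevel : ∀ v < n + 2, s₁.arr 8 v = if v = n then 1 else 0 := by
    intro v hv
    have hv' := hclear v hv
    have hvar : ((ForProg.loop 2 2 (.write 8 (var 2) (lit 0))).den s).var 0 = n := by
      rw [den_var (by decide), h0]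
    have harr : ((ForProg.loop 2 2 (.write 8 (var 2) (lit 0))).den s).arr 8 v = 0 := by
      rw [den, h0]
      exact hv'
    rw [hs₁, den]
    by_cases hvn : v = n
    · simp [den.eq_3, Expr.eval, State.setArr, hvar, hvn]
    · simp [den.eq_3, Expr.eval, State.setArr, hvar, hvn, harr]
  have hcount : 1 ≤ reachCount n (s₁.arr 8) := by
    rw [reachCount, Nat.one_le_iff_ne_zero, Finset.card_ne_zero]
    exact ⟨n, by simp [hlevel n (by omega)]⟩
  have hinv : SearchInv n A B F s₁ := by
    refine ⟨h0₁, ?_, ?_, ?_, ?_, ?_, ?_⟩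
    · rw [hs₁, den_arr (by decide), h5]
    · rw [hs₁, den_arr (by decide), h6]
    · rw [hs₁, den_arr (by decide), h7]
    · simp [hlevel n (by omega)]
    · intro v hv hv0 hvn
      simp [hlevel v hv, hvn] at hv0
    · intro v hv
      rw [hlevel v hv]
      split <;> omega
  -- The source counts before the first sweep, hence `k + 1`; after `n + 2` sweeps this would exceed
  -- the number of nodes.
  have key := iter_induction
    (f := fun k s => (ForProg.loop 3 0 relaxProg).den (s.setVar 2 k)) (s := s₁) (N := n + 2)
    (fun k s' => SearchInv n A B F s' ∧ (ResidualClosed n A B F (fun v => s'.arr 8 v ≠ 0) ∨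
      k + 1 ≤ reachCount n (s'.arr 8))) ⟨hinv, Or.inr hcount⟩ (by
      rintro k hk s' ⟨hs', hor⟩
      obtain ⟨h₁, h₂⟩ := searchInv_sweep hA hB (hs'.setVar (x := 2) (by decide) k)
      refine ⟨h₁, h₂.imp_right fun ⟨h₃, h₄⟩ => ?_⟩
      have := hor.resolve_left h₃
      exact Nat.succ_le_of_lt (this.trans_lt h₄))
  rw [hden, den, h0₁]
  refine ⟨key.1.setVar (by decide) _, key.2.resolve_right ?_⟩
  have := reachCount_le (n := n) ((iter (fun k s => (ForProg.loop 3 0 relaxProg).den (s.setVar 2 k))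
    (n + 2) s₁).arr 8)
  omega

end Search

/-! ### Augmentation -/

section Walk

variable {n val : ℕ} {A B R P : ℕ → ℕ}

theorem sum_update_mul {F : ℕ → ℕ} {u : ℕ} (hu : u < n) (x : ℕ) (d : ℕ → ℤ) :
    ∑ y ∈ Finset.range n, (Function.update F u x y : ℤ) * d y =
      ∑ y ∈ Finset.range n, (F y : ℤ) * d y + ((x : ℤ) - F u) * d u := by
  have hu' := Finset.mem_range.2 hu
  rw [← Finset.add_sum_erase _ _ hu', ← Finset.add_sum_erase _ (fun y => (F y : ℤ) * d y) hu']
  have : ∑ y ∈ (Finset.range n).erase u, (Function.update F u x y : ℤ) * d y =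
      ∑ y ∈ (Finset.range n).erase u, (F y : ℤ) * d y :=
    Finset.sum_congr rfl fun y hy => by rw [Function.update_of_ne (Finset.ne_of_mem_erase hy)]
  rw [this, Function.update_self]
  ring

/-- Variable `4` holds a node to which one unit of flow has still to be sent from node `n`. -/
structure WalkInv (n : ℕ) (A B R P : ℕ → ℕ) (val : ℕ) (s : State) : Prop where
  size : s.var 0 = n
  tail : s.arr 5 = A
  head : s.arr 6 = B
  level : s.arr 8 = R
  pred : s.arr 9 = P
  le_one : ∀ u < n, s.arr 7 u ≤ 1
  sum_eq : ∀ φ : ℕ → ℤ, ∑ u ∈ Finset.range n, (s.arr 7 u : ℤ) * (φ (A u) - φ (B u)) =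
    val * (φ n - φ (n + 1)) + (φ (s.var 4) - φ (n + 1))
  node_lt : s.var 4 < n + 2
  reached : R (s.var 4) ≠ 0
  -- Higher levels are left out because arcs used earlier in the walk have been flipped.
  reach : ∀ v < n + 2, R v ≠ 0 → v ≠ n → R v ≤ R (s.var 4) → P v < n ∧
    ∃ w < n + 2, Residual A B (s.arr 7) (P v) w v ∧ R w ≠ 0 ∧ R w < R v

theorem WalkInv.setVar {s : State} (h : WalkInv n A B R P val s) {x : ℕ} (h0 : 0 ≠ x) (h4 : 4 ≠ x)
    (v : ℕ) : WalkInv n A B R P val (s.setVar x v) := by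
  have e4 : (s.setVar x v).var 4 = s.var 4 := by rw [var_setVar, if_neg h4]
  refine ⟨by rw [var_setVar, if_neg h0, h.size], h.tail, h.head, h.level, h.pred, h.le_one, ?_, ?_,
    ?_, ?_⟩ <;> rw [e4]
  exacts [h.sum_eq, h.node_lt, h.reached, h.reach]

theorem den_walkStepProg_of_eq {s : State} (h : s.var 4 = s.var 0) : walkStepProg.den s = s := by
  simp [walkStepProg, neExpr, den, Expr.eval, h]

theorem den_walkStepProg_of_ne {s : State} (h : s.var 4 ≠ s.var 0) :
    walkStepProg.den s = (ForProg.seq (.assign 5 (read 9 (var 4))) <|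
      .ite (read 7 (var 5)) (.seq (.write 7 (var 5) (lit 0)) (.assign 4 (read 6 (var 5))))
        (.seq (.write 7 (var 5) (lit 1)) (.assign 4 (read 5 (var 5))))).den s :=
  if_pos ((eval_neExpr (s := s) (e := var 4) (f := var 0)).2 h)

/-- Flipping the arc changes the potential sum by the difference between its ends, which moves the
pending unit from the current node to the next. -/
theorem WalkInv.step {s : State} (h : WalkInv n A B R P val s) (hne : s.var 4 ≠ n) :
    WalkInv n A B R P val (walkStepProg.den s) ∧ R ((walkStepProg.den s).var 4) < R (s.var 4) := by
  obtain ⟨hu, w, hw, hres, hw0, hlt⟩ := h.reach _ h.node_lt h.reached hne le_rfl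
  set u := P (s.var 4) with hudef
  have hden := den_walkStepProg_of_ne (s := s) (by rwa [h.size])
  obtain ⟨x, hx1, hF, h4, hd⟩ : ∃ x ≤ 1, (walkStepProg.den s).arr 7 = Function.update (s.arr 7) u x ∧
      (walkStepProg.den s).var 4 = w ∧
      ∀ φ : ℕ → ℤ, ((x : ℤ) - s.arr 7 u) * (φ (A u) - φ (B u)) = φ w - φ (s.var 4) := by
    rcases hres with ⟨hF, hwA, hvB⟩ | ⟨hF, hwB, hvA⟩
    · refine ⟨1, le_rfl, ?_, ?_, fun φ => by rw [hF, ← hwA, ← hvB]; push_cast; ring⟩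
      · simp [hden, den, Expr.eval, h.pred, State.setVar, State.setArr,
          ← hudef, hF]
      · simp [hden, den, Expr.eval, h.pred, State.setVar, State.setArr,
          ← hudef, hF, h.tail, hwA]
    · have hF1 : s.arr 7 u = 1 := by
        have := h.le_one u hu
        omega
      refine ⟨0, zero_le_one, ?_, ?_, fun φ => by rw [hF1, ← hwB, ← hvA]; push_cast; ring⟩
      · simp [hden, den, Expr.eval, h.pred, State.setVar, State.setArr,
          ← hudef, hF1]
      · simp [hden, den, Expr.eval, h.pred, State.setVar, State.setArr,
          ← hudef, hF1, h.head, hwB]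
  refine ⟨⟨?_, ?_, ?_, ?_, ?_, ?_, ?_, ?_, ?_, ?_⟩, by rwa [h4]⟩
  · rw [den_var (by decide), h.size]
  · rw [den_arr (by decide), h.tail]
  · rw [den_arr (by decide), h.head]
  · rw [den_arr (by decide), h.level]
  · rw [den_arr (by decide), h.pred]
  · intro y hy
    rw [hF, Function.update_apply]
    split
    · exact hx1
    · exact h.le_one y hy
  · intro φ
    rw [hF, sum_update_mul hu x fun y => φ (A y) - φ (B y), h.sum_eq, hd, h4]
    ring
  · rwa [h4]
  · rwa [h4]
  · intro v hv hv0 hvn hle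
    rw [h4] at hle
    obtain ⟨h₁, y, hy, h₂, h₃⟩ := h.reach v hv hv0 hvn (hle.trans hlt.le)
    refine ⟨h₁, y, hy, ?_, h₃⟩
    -- The flow on `u` determines the head of its residual arc, so `P v = u` would make `v` the node
    -- just left, whose level is too high.
    have hPv : P v ≠ u := by
      intro hPv
      rw [hPv] at h₂
      rw [hres.right_unique h₂] at hlt
      omega
    rw [hF]
    simpa [Residual, hPv] using h₂

theorem walkProg_spec {F : ℕ → ℕ} {s : State} (hs : SearchInv n A B F s)
    (hflow : IsUnitFlow n A B F val) :
    (s.arr 8 (n + 1) = 0 → (walkProg.den s).arr = s.arr) ∧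
    (s.arr 8 (n + 1) ≠ 0 → IsUnitFlow n A B ((walkProg.den s).arr 7) (val + 1)) := by
  have h0 : ∀ x, ((ForProg.assign 4 x).den s).var 0 = n := fun x => by
    rw [den, var_setVar, if_neg (by decide), hs.size]
  constructor
  · intro ht
    have hden : walkProg.den s =
        (ForProg.loop 2 2 walkStepProg).den ((ForProg.assign 4 (var 0)).den s) := by
      simp [walkProg, den, Expr.eval, hs.size, ht]
    have key := iter_induction (f := fun k s => walkStepProg.den (s.setVar 2 k))
      (s := (ForProg.assign 4 (var 0)).den s) (N := n + 2)
      (fun k s' => s'.var 4 = s'.var 0 ∧ s'.arr = s.arr)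
      ⟨by rw [h0]; simp [den, Expr.eval, var_setVar, hs.size], rfl⟩ (by
        rintro k - s' ⟨h₁, h₂⟩
        have h₁' : (s'.setVar 2 k).var 4 = (s'.setVar 2 k).var 0 := by simpa [var_setVar] using h₁
        rw [den_walkStepProg_of_eq h₁']
        exact ⟨h₁', h₂⟩)
    rw [hden, den_loop, h0]
    exact key.2
  · intro ht
    have hden : walkProg.den s = (ForProg.loop 2 2 walkStepProg).den
        ((ForProg.assign 4 (add (var 0) (lit 1))).den s) := by
      simp [walkProg, den, Expr.eval, hs.size, ht]
    have h4 : ((ForProg.assign 4 (add (var 0) (lit 1))).den s).var 4 = n + 1 := by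
      simp [den, Expr.eval, var_setVar, hs.size]
    have hinit : WalkInv n A B (s.arr 8) (s.arr 9) val
        ((ForProg.assign 4 (add (var 0) (lit 1))).den s) := by
      refine ⟨h0 _, hs.tail, hs.head, rfl, rfl, ?_, ?_, ?_, ?_, ?_⟩
      · intro u hu
        change s.arr 7 u ≤ 1
        rw [hs.flow]
        exact hflow.le_one u hu
      · intro φ
        rw [h4]
        change ∑ u ∈ Finset.range n, (s.arr 7 u : ℤ) * (φ (A u) - φ (B u)) = _
        rw [hs.flow, hflow.sum_eq]
        ring
      · omega
      · rwa [h4]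
      · intro v hv hv0 hvn _
        change _ ∧ ∃ w < n + 2, Residual A B (s.arr 7) _ w v ∧ _
        rw [hs.flow]
        exact hs.reach v hv hv0 hvn
    -- The level starts at no more than `n + 2` and drops in each step, so after `n + 2` steps a
    -- node other than `n` would have level `0`, that is, be unreached.
    have key := iter_induction (f := fun k s => walkStepProg.den (s.setVar 2 k))
      (s := (ForProg.assign 4 (add (var 0) (lit 1))).den s) (N := n + 2)
      (fun k s' => WalkInv n A B (s.arr 8) (s.arr 9) val s' ∧
        (s'.var 4 = n ∨ s.arr 8 (s'.var 4) + k ≤ n + 2))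
      ⟨hinit, Or.inr (by
        rw [h4]
        exact (hs.level_le _ (by omega)).trans (reachCount_le _))⟩ (by
        rintro k - s' ⟨h₁, h₂⟩
        have h₁' := h₁.setVar (x := 2) (by decide) (by decide) k
        have e4 : (s'.setVar 2 k).var 4 = s'.var 4 := by simp [var_setVar]
        by_cases hn : s'.var 4 = n
        · rw [den_walkStepProg_of_eq (by rw [e4, hn, h₁'.size])]
          exact ⟨h₁', Or.inl (e4.trans hn)⟩
        · obtain ⟨h₃, h₄⟩ := h₁'.step (by rwa [e4])
          refine ⟨h₃, Or.inr ?_⟩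
          rw [e4] at h₄
          have := h₂.resolve_left hn
          omega)
    obtain ⟨hw, hor⟩ := key
    have hn := hor.resolve_right fun h => hw.reached (by omega)
    rw [hden, den_loop, h0]
    refine ⟨hw.le_one, fun φ => ?_⟩
    have := hw.sum_eq φ
    rw [hn] at this
    change ∑ u ∈ Finset.range n, ((iter _ (n + 2) _).arr 7 u : ℤ) * _ = _
    rw [this]
    push_cast
    ring

end Walk

/-! ### The flow algorithm -/

section Flow

variable {n : ℕ} {A B : ℕ → ℕ}

/-- Array `8` holds a cut through which no residual arc leads. -/
def IsSaturated (n : ℕ) (A B : ℕ → ℕ) (s : State) : Prop :=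
  s.arr 8 n ≠ 0 ∧ s.arr 8 (n + 1) = 0 ∧ ResidualClosed n A B (s.arr 7) fun v => s.arr 8 v ≠ 0

/-- Once a saturated cut is found its size equals the flow value, so no later round can augment.
Without one, `n + 1` rounds would push the value above the size of the cut around the source. -/
theorem flowProg_spec (hA : ∀ u < n, A u < n + 2) (hB : ∀ u < n, B u < n + 2) {s : State}
    (h0 : s.var 0 = n) (h5 : s.arr 5 = A) (h6 : s.arr 6 = B) (h7 : ∀ u, s.arr 7 u = 0) :
    (∃ val, IsUnitFlow n A B ((flowProg.den s).arr 7) val) ∧ IsSaturated n A B (flowProg.den s) := by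
  have key := iter_induction (f := fun k s => (ForProg.seq searchProg walkProg).den (s.setVar 1 k))
    (s := s) (N := n + 1)
    (fun k s' => s'.var 0 = n ∧ s'.arr 5 = A ∧ s'.arr 6 = B ∧
      ∃ val, IsUnitFlow n A B (s'.arr 7) val ∧ (k ≤ val ∨ IsSaturated n A B s'))
    ⟨h0, h5, h6, 0, ⟨by simp [h7], by simp [h7]⟩, Or.inl le_rfl⟩ (by
      rintro k - s' ⟨h₀, h₅, h₆, val, hflow, hor⟩
      refine ⟨by rw [den_var (by decide), var_setVar, if_neg (by decide), h₀],
        by rw [den_arr (by decide)]; exact h₅, by rw [den_arr (by decide)]; exact h₆, ?_⟩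
      have h₀' : (s'.setVar 1 k).var 0 = n := by rw [var_setVar, if_neg (by decide), h₀]
      obtain ⟨hs, hc⟩ := searchInv_searchProg (s := s'.setVar 1 k) hA hB h₀' h₅ h₆ rfl
      change SearchInv n A B (s'.arr 7) _ at hs
      change ResidualClosed n A B (s'.arr 7) _ at hc
      obtain ⟨hw₁, hw₂⟩ := walkProg_spec hs hflow
      rw [den]
      by_cases ht : (searchProg.den (s'.setVar 1 k)).arr 8 (n + 1) = 0
      · rw [IsSaturated, hw₁ ht, hs.flow]
        exact ⟨val, hflow, Or.inr ⟨hs.source, ht, hc⟩⟩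
      · refine ⟨val + 1, hw₂ ht, Or.inl ?_⟩
        rcases hor with hle | ⟨hsrc, hsink, hcl⟩
        · omega
        · have h₁ := hflow.val_eq_cutSize hsrc (not_not.2 hsink) hcl
          have h₂ := (hw₂ ht).val_le_cutSize (X := fun v => s'.arr 8 v ≠ 0) hsrc (not_not.2 hsink)
          omega)
  obtain ⟨-, -, -, val, hflow, hor⟩ := key
  have harr : (flowProg.den s).arr =
      (iter (fun k s => (ForProg.seq searchProg walkProg).den (s.setVar 1 k)) (n + 1) s).arr := by
    rw [flowProg, den_loop_arr, h0]
  rw [IsSaturated, harr]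
  refine ⟨⟨val, hflow⟩, hor.resolve_left fun h => ?_⟩
  have h₁ := hflow.val_le_cutSize (X := fun v => v = n) rfl (by simp)
  have h₂ := cutSize_le (n := n) (A := A) (B := B) (X := fun v => v = n)
  omega

end Flow

/-! ### Reading the input and writing the output -/

theorem parentProg_spec {n : ℕ} {G : PrefGraph (Fin n)} {vs adj out r a : ℕ}
    (hvs : vs ≠ out) (hadj : adj ≠ out) {s : State} (h0 : s.var 0 = n)
    (hv : ∀ u : Fin n, s.arr vs u ≠ 0 ↔ u ∈ G.verts)
    (hm : ∀ p u : Fin n, s.arr adj (p * n + u) ≠ 0 ↔ G.Adj p u) :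
    IsParentMap G (n + r) (n + a) (((parentProg vs adj out r a).den s).arr out) := by
  set row : ForProg := .seq (.ite (read adj (var 2)) (.write out (var 1) (var 3)) .skip)
    (.assign 2 (add (var 2) (var 0))) with hrow
  set body : ForProg := .seq (.ite (read vs (var 1)) (.write out (var 1) (add (var 0) (lit r)))
      (.write out (var 1) (add (var 0) (lit a)))) <|
    .seq (.assign 2 (var 1)) <| .loop 3 0 row with hbody
  have frame : ∀ b, b ≠ out → body.writes b = false := fun b hb => by
    simp [hbody, hrow, writes, hb]
  have hvar0 : body.assigns 0 = false := by simp [hbody, hrow, assigns]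
  have hbodyden : ∀ (u : Fin n) (s' : State), s'.var 0 = n → s'.var 1 = u →
      s'.arr vs = s.arr vs → s'.arr adj = s.arr adj →
      ((∃ p : Fin n, G.Adj p u ∧ (body.den s').arr out u = p) ∨
        ((∀ p, ¬ G.Adj p u) ∧ ((u ∈ G.verts ∧ (body.den s').arr out u = n + r) ∨
          (u ∉ G.verts ∧ (body.den s').arr out u = n + a)))) ∧
      ∀ w, w ≠ (u : ℕ) → (body.den s').arr out w = s'.arr out w := by
    intro u s' h₀ h₁ hvs' hadj'
    obtain ⟨s₁, hs₁⟩ : ∃ s₁, s₁ = (ForProg.seq (.ite (read vs (var 1))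
      (.write out (var 1) (add (var 0) (lit r))) (.write out (var 1) (add (var 0) (lit a))))
      (.assign 2 (var 1))).den s' := ⟨_, rfl⟩
    have hden : body.den s' = (ForProg.loop 3 0 row).den s₁ := by rw [hs₁]; rfl
    have hs₁0 : s₁.var 0 = n := by rw [hs₁, den_var (by simp [assigns]), h₀]
    have hs₁1 : s₁.var 1 = u := by rw [hs₁, den_var (by simp [assigns]), h₁]
    have hs₁2 : s₁.var 2 = u := by
      rw [hs₁]
      have : ((ForProg.ite (read vs (var 1))
        (.write out (var 1) (add (var 0) (lit r)))
        (.write out (var 1) (add (var 0) (lit a)))).den s').var 1 = u := by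
        rw [den_var (by simp [assigns]), h₁]
      rw [den, den.eq_2, var_setVar, if_pos rfl, Expr.eval, this]
    have hs₁adj : s₁.arr adj = s.arr adj := by
      rw [hs₁, den_arr (by simp [writes, hadj]), hadj']
    have hs₁out : s₁.arr out u = (if u ∈ G.verts then n + r else n + a) ∧
        ∀ w, w ≠ (u : ℕ) → s₁.arr out w = s'.arr out w := by
      have hvu := hv u
      rw [← hvs'] at hvu
      rw [hs₁]
      by_cases hu : u ∈ G.verts
      · have := hvu.2 hu
        simp +contextual [den, Expr.eval, h₁, this, hu, State.setArr, State.setVar, h₀]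
      · have : s'.arr vs u = 0 := not_not.1 fun h => hu (hvu.1 h)
        simp +contextual [den, Expr.eval, h₁, this, hu, State.setArr, State.setVar, h₀]
    -- Variable `2` descends column `u` of the matrix by repeated addition of `n`, as the machine
    -- cannot multiply.
    have key := iter_induction (f := fun k s => row.den (s.setVar 3 k)) (s := s₁) (N := n)
      (fun k s'' => s''.var 0 = n ∧ s''.var 1 = u ∧ s''.var 2 = k * n + u ∧
        s''.arr adj = s.arr adj ∧ (∀ w, w ≠ (u : ℕ) → s''.arr out w = s'.arr out w) ∧
        ((∃ p : Fin n, G.Adj p u ∧ s''.arr out u = p) ∨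
          ((∀ p : Fin n, (p : ℕ) < k → ¬ G.Adj p u) ∧
            s''.arr out u = if u ∈ G.verts then n + r else n + a)))
      ⟨hs₁0, hs₁1, by simpa using hs₁2, hs₁adj, hs₁out.2, Or.inr ⟨by simp, hs₁out.1⟩⟩ (by
        rintro k hk s'' ⟨g0, g1, g2, gadj, gout, gor⟩
        have hku := hm ⟨k, hk⟩ u
        simp only [← gadj] at hku
        refine ⟨?_, ?_, ?_, ?_, ?_⟩
        · rw [den_var (by simp [hrow, assigns]), var_setVar, if_neg (by decide), g0]
        · rw [den_var (by simp [hrow, assigns]), var_setVar, if_neg (by decide), g1]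
        · have e2 : ∀ s : State, ((ForProg.ite (read adj (var 2))
              (.write out (var 1) (var 3)) .skip).den s).var 2 = s.var 2 := fun s =>
            den_var (by simp [assigns]) s
          have e0 : ∀ s : State, ((ForProg.ite (read adj (var 2))
              (.write out (var 1) (var 3)) .skip).den s).var 0 = s.var 0 := fun s =>
            den_var (by simp [assigns]) s
          rw [hrow, den, den.eq_2, var_setVar, if_pos rfl]
          simp [Expr.eval, e2, e0, var_setVar, g0, g2]
          ring
        · rw [den_arr (by simp [hrow, writes, hadj])]
          exact gadj
        · by_cases hpu : G.Adj ⟨k, hk⟩ u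
          · have := hku.2 hpu
            refine ⟨fun w hw => ?_, Or.inl ⟨⟨k, hk⟩, hpu, ?_⟩⟩
            · simp [hrow, den, Expr.eval, State.setVar, State.setArr, g1, g2, this, hw, gout w hw]
            · simp [hrow, den, Expr.eval, State.setVar, State.setArr, g1, g2, this]
          · have : s''.arr adj (k * n + u) = 0 := not_not.1 fun h => hpu (hku.1 h)
            have hsame : (row.den (s''.setVar 3 k)).arr = s''.arr := by
              simp [hrow, den, Expr.eval, State.setVar, g2, this]
            rw [hsame]
            refine ⟨gout, gor.imp_right fun ⟨h₁, h₂⟩ => ⟨fun p hp => ?_, h₂⟩⟩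
            rcases Nat.lt_succ_iff_lt_or_eq.1 hp with hp | hp
            · exact h₁ p hp
            · rwa [show p = ⟨k, hk⟩ from Fin.ext hp])
    obtain ⟨-, -, -, -, hout, hor⟩ := key
    have harr : (body.den s').arr = (iter (fun k s => row.den (s.setVar 3 k)) n s₁).arr := by
      rw [hden, den_loop_arr, hs₁0]
      rfl
    rw [harr]
    refine ⟨hor.imp_right fun ⟨h₁, h₂⟩ => ⟨fun p => h₁ p p.2, ?_⟩, hout⟩
    by_cases hu : u ∈ G.verts
    · exact Or.inl ⟨hu, by rw [h₂, if_pos hu]⟩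
    · exact Or.inr ⟨hu, by rw [h₂, if_neg hu]⟩
  have key := iter_induction (f := fun k s => body.den (s.setVar 1 k)) (s := s) (N := n)
    (fun k s' => s'.var 0 = n ∧ s'.arr vs = s.arr vs ∧ s'.arr adj = s.arr adj ∧
      ∀ u : Fin n, (u : ℕ) < k → (∃ p : Fin n, G.Adj p u ∧ s'.arr out u = p) ∨
        ((∀ p, ¬ G.Adj p u) ∧ ((u ∈ G.verts ∧ s'.arr out u = n + r) ∨
          (u ∉ G.verts ∧ s'.arr out u = n + a))))
    ⟨h0, rfl, rfl, by simp⟩ (by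
      rintro k hk s' ⟨h₀, hvs', hadj', hu'⟩
      have e0 : (s'.setVar 1 k).var 0 = n := by rw [var_setVar, if_neg (by decide), h₀]
      obtain ⟨hb₁, hb₂⟩ := hbodyden ⟨k, hk⟩ (s'.setVar 1 k) e0 (by simp [var_setVar]) hvs' hadj'
      refine ⟨by rw [den_var hvar0, e0], by rw [den_arr (frame _ hvs)]; exact hvs',
        by rw [den_arr (frame _ hadj)]; exact hadj', fun u hu => ?_⟩
      rcases Nat.lt_succ_iff_lt_or_eq.1 hu with hu | hu
      · rw [hb₂ u hu.ne]
        exact hu' u hu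
      · obtain rfl : u = ⟨k, hk⟩ := Fin.ext hu
        exact hb₁)
  have harr : ((parentProg vs adj out r a).den s).arr =
      (iter (fun k s => body.den (s.setVar 1 k)) n s).arr := by
    rw [parentProg, den_loop_arr, h0]
    rfl
  intro u
  rw [harr]
  exact key.2.2.2 u u.2

theorem outputProg_spec {n : ℕ} {s : State} (h0 : s.var 0 = n) :
    IsCutAllocation n (s.arr 5) (s.arr 6) (fun v => s.arr 8 v ≠ 0) ((outputProg.den s).arr 4) := by
  set body : ForProg := .ite (neExpr (read 6 (var 1)) (var 0))
      (.ite (neExpr (read 6 (var 1)) (add (var 0) (lit 1)))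
        (.ite (read 8 (read 5 (var 1))) (.write 4 (var 1) (lit 1)) (.write 4 (var 1) (lit 2)))
        (.ite (neExpr (read 5 (var 1)) (var 0)) (.write 4 (var 1) (lit 2))
          (.ite (read 8 (var 1)) (.write 4 (var 1) (lit 2)) (.write 4 (var 1) (lit 1)))))
      (.write 4 (var 1) (lit 1)) with hbody
  have hden : ∀ s', body.den s' = s'.setArr 4 (s'.var 1)
      (if s'.arr 6 (s'.var 1) = s'.var 0 then 1
        else if s'.arr 6 (s'.var 1) = s'.var 0 + 1 then
          (if s'.arr 5 (s'.var 1) = s'.var 0 ∧ ¬ s'.arr 8 (s'.var 1) ≠ 0 then 1 else 2)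
        else if s'.arr 8 (s'.arr 5 (s'.var 1)) ≠ 0 then 1 else 2) := by
    intro s'
    rw [hbody, den_ite_neExpr, den_ite_neExpr, den_ite_neExpr]
    simp only [den, Expr.eval]
    by_cases h₁ : s'.arr 6 (s'.var 1) = s'.var 0
    · simp [h₁]
    by_cases h₂ : s'.arr 6 (s'.var 1) = s'.var 0 + 1
    · by_cases h₃ : s'.arr 5 (s'.var 1) = s'.var 0 <;> by_cases h₄ : s'.arr 8 (s'.var 1) = 0 <;>
        simp [h₂, h₃, h₄]
    · by_cases h₃ : s'.arr 8 (s'.arr 5 (s'.var 1)) = 0 <;> simp [h₁, h₂, h₃]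
  have key := iter_induction (f := fun k s => body.den (s.setVar 1 k)) (s := s) (N := n)
    (fun k s' => s'.var 0 = n ∧ s'.arr 5 = s.arr 5 ∧ s'.arr 6 = s.arr 6 ∧ s'.arr 8 = s.arr 8 ∧
      ∀ u < k, s'.arr 4 u = if s.arr 6 u = n then 1
        else if s.arr 6 u = n + 1 then (if s.arr 5 u = n ∧ ¬ s.arr 8 u ≠ 0 then 1 else 2)
        else if s.arr 8 (s.arr 5 u) ≠ 0 then 1 else 2)
    ⟨h0, rfl, rfl, rfl, by simp⟩ (by
      rintro k hk s' ⟨h₀, h₅, h₆, h₈, h₄⟩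
      refine ⟨by rw [den_var (by decide), var_setVar, if_neg (by decide), h₀],
        by rw [den_arr (by decide)]; exact h₅, by rw [den_arr (by decide)]; exact h₆,
        by rw [den_arr (by decide)]; exact h₈, fun u hu => ?_⟩
      have e1 : (s'.setVar 1 k).var 1 = k := by simp [var_setVar]
      have e0 : (s'.setVar 1 k).var 0 = n := by rw [var_setVar, if_neg (by decide), h₀]
      have ea : (s'.setVar 1 k).arr = s'.arr := rfl
      rw [hden, e1, e0, ea, h₅, h₆, h₈]
      rcases Nat.lt_succ_iff_lt_or_eq.1 hu with hu | rfl
      · rw [← h₄ u hu]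
        simp [State.setArr, State.setVar, hu.ne]
      · simp [State.setArr])
  have harr : (outputProg.den s).arr = (iter (fun k s => body.den (s.setVar 1 k)) n s).arr := by
    rw [outputProg, den_loop_arr, h0]
    rfl
  rw [IsCutAllocation, harr]
  exact key.2.2.2.2

theorem inputState_arr_vertex {n : ℕ} (G : Fin 2 → PrefGraph (Fin n)) (i : Fin 2) (u : Fin n) :
    (inputState G).arr i u ≠ 0 ↔ u ∈ (G i).verts := by
  simp only [inputState, ne_eq, ite_eq_right_iff, one_ne_zero, imp_false, not_not]
  constructor
  · rintro ⟨j, ⟨hij, v, hv, huv⟩ | ⟨hij, -⟩⟩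
    · obtain rfl := Fin.ext hij
      rwa [Fin.ext huv]
    · omega
  · exact fun h => ⟨i, Or.inl ⟨rfl, u, h, rfl⟩⟩

theorem inputState_arr_adj {n : ℕ} (G : Fin 2 → PrefGraph (Fin n)) (i : Fin 2) (p u : Fin n) :
    (inputState G).arr (2 + i) (p * n + u) ≠ 0 ↔ (G i).Adj p u := by
  simp only [inputState, ne_eq, ite_eq_right_iff, one_ne_zero, imp_false, not_not]
  constructor
  · rintro ⟨j, ⟨hij, -⟩ | ⟨hij, v, w, hvw, h⟩⟩
    · omega
    · obtain rfl : i = j := Fin.ext (by omega)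
      have hn : 0 < n := p.pos
      have hp : (p : ℕ) = v := by
        have := congrArg (· / n) h
        simpa [mul_comm _ n, Nat.mul_add_div hn,
          Nat.div_eq_of_lt p.2, Nat.div_eq_of_lt u.2, Nat.div_eq_of_lt w.2] using this
      have hu : (u : ℕ) = w := by rw [hp] at h; omega
      rwa [Fin.ext hp, Fin.ext hu]
  · exact fun h => ⟨i, Or.inr ⟨rfl, p, u, h, rfl⟩⟩

/-- Weak duality closes the chain: output dissatisfaction ≤ final cut = flow value ≤ cut of any
competitor ≤ its dissatisfaction. -/
theorem allocationProg_isOptimal {n : ℕ} {G : Fin 2 → PrefGraph (Fin n)}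
    (hG : ∀ i, (G i).IsStarForest) :
    IsOptimal G (outputAllocation n (allocationProg.den (inputState G))) := by
  classical
  obtain ⟨s₁, hs₁⟩ : ∃ s₁, s₁ = (parentProg 0 2 5 0 1).den (inputState G) := ⟨_, rfl⟩
  obtain ⟨s₂, hs₂⟩ : ∃ s₂, s₂ = (parentProg 1 3 6 1 0).den s₁ := ⟨_, rfl⟩
  obtain ⟨s₃, hs₃⟩ : ∃ s₃, s₃ = flowProg.den s₂ := ⟨_, rfl⟩
  have hden : allocationProg.den (inputState G) = outputProg.den s₃ := by
    rw [hs₃, hs₂, hs₁]; rfl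
  have h0₁ : s₁.var 0 = n := by
    rw [hs₁, den_var (by decide)]
    simp [inputState]
  have h0₂ : s₂.var 0 = n := by rw [hs₂, den_var (by decide), h0₁]
  have h0₃ : s₃.var 0 = n := by rw [hs₃, den_var (by decide), h0₂]
  have hA : IsParentMap (G 0) n (n + 1) (s₂.arr 5) := by
    rw [hs₂, den_arr (by decide), hs₁]
    exact parentProg_spec (by decide) (by decide) (by simp [inputState])
      (inputState_arr_vertex G 0) (inputState_arr_adj G 0)
  have hB : IsParentMap (G 1) (n + 1) n (s₂.arr 6) := by
    rw [hs₂]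
    refine parentProg_spec (by decide) (by decide) h0₁ ?_ ?_ <;>
      rw [hs₁, den_arr (by decide)]
    · exact inputState_arr_vertex G 1
    · exact inputState_arr_adj G 1
  -- The untouched array `7` serves as the initial zero flow.
  have h7 : ∀ u, s₂.arr 7 u = 0 := by
    intro u
    rw [hs₂, den_arr (by decide), hs₁, den_arr (by decide)]
    simp only [inputState]
    refine if_neg ?_
    rintro ⟨i, ⟨h, -⟩ | ⟨h, -⟩⟩ <;> omega
  obtain ⟨⟨val, hflow⟩, hsrc, hsink, hcl⟩ := flowProg_spec (hA.lt (by omega) (by omega))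
    (hB.lt (by omega) (by omega)) h0₂ rfl rfl h7
  rw [← hs₃] at hflow hsrc hsink hcl
  have hout := outputProg_spec h0₃
  rw [show s₃.arr 5 = s₂.arr 5 by rw [hs₃, den_arr (by decide)],
    show s₃.arr 6 = s₂.arr 6 by rw [hs₃, den_arr (by decide)]] at hout
  rw [hden]
  have mem : ∀ i u, u ∈ outputAllocation n (outputProg.den s₃) i ↔
      (outputProg.den s₃).arr 4 u = (i : ℕ) + 1 := by
    simp [outputAllocation]
  refine ⟨fun i j hij => Finset.disjoint_left.2 fun v hi hj => hij (Fin.ext ?_), fun π hπ => ?_⟩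
  · rw [mem] at hi hj
    omega
  · obtain ⟨X, hXs, hXt, hX⟩ := exists_cutSize_le hG hA hB hπ
    calc totalDissatisfaction G (outputAllocation n (outputProg.den s₃))
        ≤ cutSize n (s₂.arr 5) (s₂.arr 6) fun v => s₃.arr 8 v ≠ 0 :=
          totalDissatisfaction_le_cutSize hG hA hB hsrc (not_not.2 hsink) hout mem
      _ = val := (hflow.val_eq_cutSize hsrc (not_not.2 hsink) hcl).symm
      _ ≤ cutSize n (s₂.arr 5) (s₂.arr 6) X := hflow.val_le_cutSize hXs hXt
      _ ≤ totalDissatisfaction G π := hX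

end RAM

/-! ### The main theorem -/

theorem mainTheorem8 :
    -- an allocation of minimum total dissatisfaction is found in polynomial time
    (∃ (c : RAM.Cmd) (p : Polynomial ℕ), ∀ (n : ℕ) (G : Fin 2 → PrefGraph (Fin n)),
      (∀ i, (G i).IsDisjointUnionOfOutStars) →
        ∃ (t : ℕ) (s : RAM.State), RAM.Exec c (RAM.inputState G) t s ∧ t ≤ p.eval n ∧
          IsOptimal G (RAM.outputAllocation n s)) ∧
    -- preassignment and reduction
    (∀ (V : Type*) [Fintype V] (G : Fin 2 → PrefGraph V),
      (∀ i, (G i).IsDisjointUnionOfOutStars) →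
        (∃ π : Fin 2 → Finset V, IsOptimal G π ∧ IsCompliant G π) ∧
        (∃ π₀ : Fin 2 → Finset V, IsPreassignment G π₀) ∧
        ∀ π₀ : Fin 2 → Finset V, IsPreassignment G π₀ →
          (residualGraph G π₀).IsBipartite ∧
          ∀ S : Finset (ResidualVertex G π₀),
            (residualGraph G π₀).IsIndepSet (S : Set (ResidualVertex G π₀)) →
              IsAllocation (inducedAllocation G π₀ S) ∧
              setWeight G π₀ S + totalDissatisfaction G (inducedAllocation G π₀ S) =
                totalDissatisfaction G π₀ ∧
              (IsMaxWeightIndepSet G π₀ S ↔ IsOptimal G (inducedAllocation G π₀ S))) := by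
  refine ⟨⟨RAM.allocationProg.cmd, RAM.allocationProg.time, fun n G hG => ?_⟩, fun V _ G hG => ?_⟩
  · obtain ⟨t, ht, hle⟩ := RAM.ForProg.exec_cmd (p := RAM.allocationProg) (by decide)
      (RAM.inputState G)
    refine ⟨t, _, ht, ?_, RAM.allocationProg_isOptimal fun i => (hG i).isStarForest⟩
    simpa [RAM.inputState] using hle
  · have hF := fun i => (hG i).isStarForest
    exact ⟨exists_isOptimal_isCompliant hF, exists_isPreassignment hF, fun π₀ h₀ =>
      ⟨h₀.2.1.residualGraph_isBipartite hF, fun S hS =>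
        ⟨isAllocation_inducedAllocation h₀.1 hS, setWeight_add_totalDissatisfaction hF hS,
          h₀.isMaxWeightIndepSet_iff hF hS⟩⟩⟩
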